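/- Let $V$ be a real vector space of finite dimension $n\ge 1$ and let $K\subset V$ be a compact convex set containing the origin $o$ in its interior, with Minkowski functional $F$ (the positive function, homogeneous of degree one, with $\{F=1\}=\partial K$). For $p\in\partial K$ let $a(p)>0$ be defined by $-a(p)p\in\partial K$. A point $p\in\partial K$ is called smooth if $F$ has a second order Taylor expansion at $p$ (by Alexandroff's theorem almost every $p$ is smooth); the tangent space is then $T_p\partial K=\ker dF_p$. Intrinsic definition. The projective gauge function is the two-valued function $G_K(x)=2[q_1,o,x,q_2]$, where $q_1,q_2$ are the two points of $\partial K$ on the line through $o$ and $x\neq o$, and $[q_1,o,x,q_2]=\frac{(x-o)(q_2-q_1)}{(x-q_1)(q_2-o)}$ in an affine coordinate of this line. At $p\in\partial K$ its two values are $2$ and $\infty$; let $G_K^+$ be the branch with value $2$ on $\partial K$ (that is, $q_2$ lies on the ray from $o$ through $x$). For a smooth point $p$ and $v\in T_p\partial K$ put $\|v\|_p^2=\mathrm{Hess}_pG_K^+(v,v)$, where the Hessian is that of the restriction of $G_K^+$ to $p+T_p\partial K$, which has $p$ as a critical point. Let $|\omega_p|(v_1,\dots,v_{n-1})=\sqrt{\det(\mathrm{Hess}_pG_K^+(v_i,v_j))}$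 be the induced volume density on $\partial K$. The centro-projective area of $K$ is $$\mathcal A_p(K)=\int_{\partial K}|\omega_p|\in[0,\infty],$$ the integral of a density being computed in the two central charts $u\mapsto y/F(y)$, $y=\pm(b_0+\sum_{i=1}^{n-1}u_ib_i)$, $u\in\mathbb R^{n-1}$, for a basis $b_0,\dots,b_{n-1}$ of $V$; non-smooth points do not contribute. Proposition. For every scalar product $\langle\cdot,\cdot\rangle$ on $V$ and every basis $b_0,\dots,b_{n-1}$, $$\mathcal A_p(K)=\int_{\partial K}\frac{\sqrt{k}}{\langle n,p\rangle^{\frac{n-1}{2}}}\left(\frac{2a}{1+a}\right)^{\frac{n-1}{2}}\,dA,$$ where $k(p)$ is the Gauss curvature of $\partial K$ and $n(p)$ (in $\langle n,p\rangle$) the outer unit normal vector at a smooth point $p$, and $dA$ is the Euclidean area. In particular, the right-hand side does not depend on the choice of the scalar product: if $T:V\to V'$ is a linear isomorphism of Euclidean spaces, then the right-hand sides for $K$ and for $T(K)$ agree. -/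

import Mathlib

open MeasureTheory Topology Asymptotics Module

noncomputable section

/-! ### Convex bodies around the origin -/

/-- A convex body of a finite-dimensional real vector space with the origin in its interior.
Its Minkowski functional is Mathlib's `gauge K`. -/
structure IsPointedConvexBody {V : Type*} [NormedAddCommGroup V] [NormedSpace ℝ V]
    (K : Set V) : Prop where
  convex : Convex ℝ K
  isCompact : IsCompact K
  zero_mem_interior : (0 : V) ∈ interior K

namespace IsPointedConvexBody

variable {V : Type*} [NormedAddCommGroup V] [NormedSpace ℝ V] {K : Set V}

theorem mem_nhds (hK : IsPointedConvexBody K) : K ∈ 𝓝 (0 : V) :=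
  mem_interior_iff_mem_nhds.1 hK.zero_mem_interior

theorem gauge_pos (hK : IsPointedConvexBody K) {x : V} (hx : x ≠ 0) : 0 < gauge K x :=
  (_root_.gauge_pos (absorbent_nhds_zero hK.mem_nhds)
    (hK.isCompact.isVonNBounded ℝ)).2 hx

theorem smul_mem_frontier_iff (hK : IsPointedConvexBody K) {x : V} (hx : x ≠ 0) (t : ℝ) :
    t • x ∈ frontier K ↔ t = (gauge K x)⁻¹ ∨ t = -(gauge K (-x))⁻¹ := by
  have h1 := hK.gauge_pos hx
  have h2 := hK.gauge_pos (neg_ne_zero.2 hx)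
  have e1 : 0 < (gauge K x)⁻¹ := inv_pos.2 h1
  have e2 : 0 < (gauge K (-x))⁻¹ := inv_pos.2 h2
  rw [← gauge_eq_one_iff_mem_frontier hK.convex hK.mem_nhds]
  rcases le_total 0 t with ht | ht
  · rw [gauge_smul_of_nonneg ht, smul_eq_mul]
    constructor
    · intro h
      exact Or.inl (eq_inv_of_mul_eq_one_left h)
    · rintro (h | h)
      · rw [h, inv_mul_cancel₀ h1.ne']
      · linarith
  · have : t • x = (-t) • (-x) := by simp
    rw [this, gauge_smul_of_nonneg (by linarith), smul_eq_mul]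
    constructor
    · intro h
      have := eq_inv_of_mul_eq_one_left h
      exact Or.inr (by linarith)
    · rintro (h | h)
      · linarith
      · rw [h, neg_neg, inv_mul_cancel₀ h2.ne']

end IsPointedConvexBody

/-- The antipodal function `a`: for a boundary point `p`, the positive number `t` such that
`-t p` is a boundary point. -/
def antipodalFun {V : Type*} [NormedAddCommGroup V] [NormedSpace ℝ V] (K : Set V) (p : V) : ℝ :=
  (gauge K (-p))⁻¹

theorem antipodalFun_unique {V : Type*} [NormedAddCommGroup V] [NormedSpace ℝ V] {K : Set V}
    (hK : IsPointedConvexBody K) {p : V} (hp : p ∈ frontier K) {t : ℝ} :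
    (0 < t ∧ -(t • p) ∈ frontier K) ↔ t = antipodalFun K p := by
  have hp0 : p ≠ 0 := by
    rintro rfl
    exact hp.2 hK.zero_mem_interior
  have h1 := inv_pos.2 (hK.gauge_pos hp0)
  have h2 := inv_pos.2 (hK.gauge_pos (neg_ne_zero.2 hp0))
  rw [← neg_smul, hK.smul_mem_frontier_iff hp0, antipodalFun]
  constructor
  · rintro ⟨h, h' | h'⟩
    · linarith
    · linarith
  · rintro rfl
    exact ⟨h2, Or.inr rfl⟩

/-- Points of the boundary where the Minkowski functional has a quadratic approximation. -/
def IsSmoothBoundaryPoint {V : Type*} [NormedAddCommGroup V] [NormedSpace ℝ V]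
    (K : Set V) (p : V) : Prop :=
  p ∈ frontier K ∧ ∃ (L : V →L[ℝ] ℝ) (B : LinearMap.BilinForm ℝ V), B.IsSymm ∧
    (fun v => gauge K (p + v) - gauge K p - L v - (1 / 2) * B v v) =o[𝓝 0] fun v => ‖v‖ ^ 2

/-- The tangent hyperplane of the boundary, at a smooth boundary point, as a linear subspace. -/
def boundaryTangent {V : Type*} [NormedAddCommGroup V] [NormedSpace ℝ V]
    (K : Set V) (p : V) : Submodule ℝ V :=
  (fderiv ℝ (gauge K) p : V →L[ℝ] ℝ).toLinearMap.ker

/-- `B` restricts on the subspace `T` to the Hessian at `0` of the restriction of `g` to `T`, where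
this restriction has zero derivative at `0`:  `g v = g 0 + B(v,v)/2 + o(|v|²)` for `v ∈ T`.
Only the values of `B` on `T` matter. -/
def IsHessianOn {V : Type*} [NormedAddCommGroup V] [NormedSpace ℝ V]
    (g : V → ℝ) (T : Submodule ℝ V) (B : LinearMap.BilinForm ℝ V) : Prop :=
  B.IsSymm ∧ (fun v => g v - g 0 - (1 / 2) * B v v) =o[𝓝[(T : Set V)] 0] fun v => ‖v‖ ^ 2

open Classical in
/-- The Hessian of `g` restricted to `T` at the critical point `0`, as a bilinear form whose values
are meaningful on `T`; zero if there is none. -/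
def hessianOn {V : Type*} [NormedAddCommGroup V] [NormedSpace ℝ V]
    (g : V → ℝ) (T : Submodule ℝ V) : LinearMap.BilinForm ℝ V :=
  if h : ∃ B, IsHessianOn g T B then h.choose else 0

/-- The Hessian is uniquely determined on `T`. -/
theorem IsHessianOn.unique {V : Type*} [NormedAddCommGroup V] [NormedSpace ℝ V]
    {g : V → ℝ} {T : Submodule ℝ V} {B C : LinearMap.BilinForm ℝ V}
    (hB : IsHessianOn g T B) (hC : IsHessianOn g T C) {v w : V} (hv : v ∈ T) (hw : w ∈ T) :
    B v w = C v w := by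
  have key : ∀ u ∈ T, B u u = C u u := by
    intro u hu
    have h := hB.2.sub hC.2
    have ht : Filter.Tendsto (fun t : ℝ => t • u) (𝓝[≠] 0) (𝓝[(T : Set V)] 0) := by
      refine tendsto_nhdsWithin_iff.2 ⟨?_, Filter.Eventually.of_forall fun t => T.smul_mem t hu⟩
      have : Filter.Tendsto (fun t : ℝ => t • u) (𝓝 0) (𝓝 ((0 : ℝ) • u)) :=
        (continuous_id.smul continuous_const).tendsto 0
      rw [zero_smul] at this
      exact this.mono_left nhdsWithin_le_nhds
    have h2 := h.comp_tendsto ht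
    have h3 : (fun t : ℝ => t ^ 2 * ((1 / 2) * (C u u - B u u))) =o[𝓝[≠] 0]
        fun t : ℝ => t ^ 2 := by
      refine (h2.congr_left ?_).trans_isBigO ?_
      · intro t
        simp only [Function.comp, map_smul, LinearMap.smul_apply, smul_eq_mul]
        ring
      · refine IsBigO.of_bound (‖u‖ ^ 2) (Filter.Eventually.of_forall fun t => ?_)
        simp [norm_smul, mul_pow, mul_comm]
    have h4 : Filter.Tendsto (fun t : ℝ => t ^ 2 * ((1 / 2) * (C u u - B u u)) / t ^ 2)
        (𝓝[≠] 0) (𝓝 0) := h3.tendsto_div_nhds_zero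
    have h5 : Filter.Tendsto (fun _ : ℝ => (1 / 2) * (C u u - B u u)) (𝓝[≠] (0 : ℝ)) (𝓝 0) := by
      refine h4.congr' ?_
      filter_upwards [self_mem_nhdsWithin] with t ht
      have : t ≠ 0 := ht
      field_simp
    have h6 := tendsto_nhds_unique h5 tendsto_const_nhds
    linarith
  have h1 := key (v + w) (T.add_mem hv hw)
  have h2 := key v hv
  have h3 := key w hw
  have h4 := hB.1.eq v w
  have h5 := hC.1.eq v w
  simp only [map_add, LinearMap.add_apply] at h1
  linarith

/-! ### The intrinsic centro-projective area -/

/-- The cross-ratio `[q₁, o, x, q₂]` of points of a projective line, in an affine coordinate. -/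
def crossRatio (q₁ o x q₂ : ℝ) : OnePoint ℝ :=
  if (x - q₁) * (q₂ - o) = 0 then OnePoint.infty
  else (((x - o) * (q₂ - q₁) / ((x - q₁) * (q₂ - o)) : ℝ) : OnePoint ℝ)

/-- The two-valued projective gauge function `x ↦ 2 [q₁, o, x, q₂]` of `K` with respect to the
origin `o`, where `q₁`, `q₂` are the two boundary points on the line through `o` and `x`. On this
line the coordinate is `t ↦ t x`, so that `o` and `x` have coordinates `0` and `1`. -/
def projGauge {V : Type*} [NormedAddCommGroup V] [NormedSpace ℝ V] (K : Set V) (x : V) :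
    Set (OnePoint ℝ) :=
  {c | ∃ s t : ℝ, s ≠ t ∧ s • x ∈ frontier K ∧ t • x ∈ frontier K ∧
    c = OnePoint.map (fun r : ℝ => 2 * r) (crossRatio s 0 1 t)}

/-- The branch of the projective gauge function which is `2` on the boundary: `q₂` is the boundary
point on the ray from `o` through `x`, and `q₁` the one on the opposite ray. -/
def projGaugePlus {V : Type*} [NormedAddCommGroup V] [NormedSpace ℝ V] (K : Set V) (x : V) : ℝ :=
  let t := (gauge K x)⁻¹
  let s := -(gauge K (-x))⁻¹
  2 * ((1 - 0) * (t - s) / ((1 - s) * (t - 0)))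

theorem projGauge_eq {V : Type*} [NormedAddCommGroup V] [NormedSpace ℝ V] {K : Set V}
    (hK : IsPointedConvexBody K) {x : V} (hx : x ≠ 0) :
    projGauge K x = {((projGaugePlus K x : ℝ) : OnePoint ℝ),
      OnePoint.map (fun r : ℝ => 2 * r)
        (crossRatio (gauge K x)⁻¹ 0 1 (-(gauge K (-x))⁻¹))} := by
  have h1 := inv_pos.2 (hK.gauge_pos hx)
  have h2 := inv_pos.2 (hK.gauge_pos (neg_ne_zero.2 hx))
  have hplus : ((projGaugePlus K x : ℝ) : OnePoint ℝ) = OnePoint.map (fun r : ℝ => 2 * r)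
      (crossRatio (-(gauge K (-x))⁻¹) 0 1 (gauge K x)⁻¹) := by
    have : (1 - -(gauge K (-x))⁻¹) * ((gauge K x)⁻¹ - 0) ≠ 0 :=
      mul_ne_zero (by linarith) (by linarith)
    rw [crossRatio, if_neg this, OnePoint.map_some, projGaugePlus]
  rw [hplus]
  ext c
  simp only [projGauge, Set.mem_ofPred_eq, Set.mem_insert_iff, Set.mem_singleton_iff,
    hK.smul_mem_frontier_iff hx]
  constructor
  · rintro ⟨s, t, hst, rfl | rfl, rfl | rfl, rfl⟩
    · exact absurd rfl hst
    · exact Or.inr rfl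
    · exact Or.inl rfl
    · exact absurd rfl hst
  · rintro (rfl | rfl)
    · exact ⟨_, _, by linarith, Or.inr rfl, Or.inl rfl, rfl⟩
    · exact ⟨_, _, by linarith, Or.inl rfl, Or.inr rfl, rfl⟩

theorem projGauge_eq_of_mem_frontier {V : Type*} [NormedAddCommGroup V] [NormedSpace ℝ V]
    {K : Set V} (hK : IsPointedConvexBody K) {p : V} (hp : p ∈ frontier K) :
    projGaugePlus K p = 2 ∧ projGauge K p = {((2 : ℝ) : OnePoint ℝ), OnePoint.infty} := by
  have hp0 : p ≠ 0 := by
    rintro rfl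
    exact hp.2 hK.zero_mem_interior
  have hg := (gauge_eq_one_iff_mem_frontier hK.convex hK.mem_nhds).2 hp
  have h2 := inv_pos.2 (hK.gauge_pos (neg_ne_zero.2 hp0))
  have h : projGaugePlus K p = 2 := by
    have : 1 + (gauge K (-p))⁻¹ ≠ 0 := by linarith
    simp [projGaugePlus, hg, div_self this]
  refine ⟨h, ?_⟩
  rw [projGauge_eq hK hp0, h, hg, crossRatio, if_pos (by simp), OnePoint.map_infty]

theorem continuousOn_projGaugePlus {V : Type*} [NormedAddCommGroup V] [NormedSpace ℝ V]
    {K : Set V} (hK : IsPointedConvexBody K) : ContinuousOn (projGaugePlus K) {0}ᶜ := by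
  have hc := continuous_gauge hK.convex hK.mem_nhds
  intro x hx
  have hx : x ≠ 0 := hx
  have h1 := hK.gauge_pos hx
  have h2 := hK.gauge_pos (neg_ne_zero.2 hx)
  have e1 := inv_pos.2 h1
  have e2 := inv_pos.2 h2
  have c1 : ContinuousAt (fun x => (gauge K x)⁻¹) x := hc.continuousAt.inv₀ h1.ne'
  have c2 : ContinuousAt (fun x => -(gauge K (-x))⁻¹) x :=
    ((hc.comp continuous_neg).continuousAt.inv₀ h2.ne').neg
  refine ContinuousAt.continuousWithinAt ?_
  refine ContinuousAt.mul continuousAt_const (ContinuousAt.div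
    (continuousAt_const.mul (c1.sub c2))
    ((continuousAt_const.sub c2).mul (c1.sub continuousAt_const)) ?_)
  exact mul_ne_zero (by linarith) (by linarith)

open Classical in
/-- The square of the centro-projective semi-norm at a boundary point `p`, polarized: the Hessian at
`p` of the restriction of the branch `projGaugePlus K` to the tangent hyperplane `p + T`. It is only
meaningful on `T`, and zero by convention if `p` is not smooth. -/
def centroProjForm {V : Type*} [NormedAddCommGroup V] [NormedSpace ℝ V]
    (K : Set V) (p : V) : LinearMap.BilinForm ℝ V :=
  if IsSmoothBoundaryPoint K p then
    hessianOn (fun v => projGaugePlus K (p + v)) (boundaryTangent K p)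
  else 0

/-- The absolute value of the centro-projective volume form, `|ω_p|(v₁, …, v_m)`. -/
def centroProjVolume {V : Type*} [NormedAddCommGroup V] [NormedSpace ℝ V]
    (K : Set V) (p : V) {m : ℕ} (v : Fin m → V) : ℝ :=
  Real.sqrt (Matrix.det (Matrix.of fun i j => centroProjForm K p (v i) (v j)))

/-- The central parametrization `u ↦ y / F(y)`, `y = ε (b₀ + ∑ uᵢ bᵢ₊₁)`, of the part of the
boundary of `K` where `ε` times the zeroth coordinate in the basis `b` is positive (`ε = ±1`). -/
def centralChart {V : Type*} [NormedAddCommGroup V] [NormedSpace ℝ V] {m : ℕ}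
    (b : Basis (Fin (m + 1)) ℝ V) (K : Set V) (ε : ℝ) (u : Fin m → ℝ) : V :=
  let y := ε • (b 0 + ∑ i, u i • b i.succ)
  (gauge K y)⁻¹ • y

/-- The integral over `∂K` of a density `ω` (a function of a boundary point and of `m = n - 1`
tangent vectors), computed in the two central charts with `ε = 1` and `ε = -1`, which are disjoint
and cover `∂K` up to a null set. -/
def boundaryDensityIntegral {V : Type*} [NormedAddCommGroup V] [NormedSpace ℝ V] {m : ℕ}
    (b : Basis (Fin (m + 1)) ℝ V) (K : Set V) (ω : V → (Fin m → V) → ℝ) : ENNReal :=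
  ∑ ε ∈ ({1, -1} : Finset ℝ), ∫⁻ u : Fin m → ℝ,
    ENNReal.ofReal (ω (centralChart b K ε u)
      fun i => fderiv ℝ (centralChart b K ε) u (Pi.single i 1))

/-- The intrinsic centro-projective area `∫_{∂K} |ω_p|`; no scalar product is used, the norm of `V`
enters only through the topology and the comparison `o(|v|²)`. -/
def centroProjArea {V : Type*} [NormedAddCommGroup V] [NormedSpace ℝ V] {m : ℕ}
    (b : Basis (Fin (m + 1)) ℝ V) (K : Set V) : ENNReal :=
  boundaryDensityIntegral b K fun p v => centroProjVolume K p v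

/-! ### The Euclidean expression -/

section Euclidean

variable {E : Type*} [NormedAddCommGroup E] [InnerProductSpace ℝ E]

/-- `ν` is an outer unit normal vector of `K` at `p`. -/
def IsOuterUnitNormal (K : Set E) (p ν : E) : Prop :=
  ‖ν‖ = 1 ∧ ∀ x ∈ K, inner ℝ ν (x - p) ≤ 0

open Classical in
/-- The outer unit normal vector (unique at smooth boundary points). -/
def outerNormal (K : Set E) (p : E) : E :=
  if h : ∃ ν, IsOuterUnitNormal K p ν then h.choose else 0

/-- Near `p` the boundary of `K` is the graph `{p + v - f(v) n : v ⊥ n}` of this function `f`, where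
`n` is the outer unit normal vector at `p`. -/
def boundaryGraph (K : Set E) (p v : E) : ℝ :=
  sInf {s : ℝ | p + v - s • outerNormal K p ∈ K}

/-- The second fundamental form of `∂K` at `p`, with respect to the inner normal: the Hessian at the
critical point `0` of the graph function on the hyperplane orthogonal to the normal. -/
def secondFundamentalForm (K : Set E) (p : E) : LinearMap.BilinForm ℝ E :=
  hessianOn (boundaryGraph K p) (Submodule.span ℝ {outerNormal K p})ᗮ

open Classical in
/-- The Gauss curvature `k(p)` at a smooth boundary point: the determinant of the second fundamental
form in an orthonormal basis of the tangent hyperplane. It is zero by convention where `p` is not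
smooth. -/
def gaussCurvature [FiniteDimensional ℝ E] (K : Set E) (p : E) : ℝ :=
  if IsSmoothBoundaryPoint K p then
    let o := stdOrthonormalBasis ℝ (Submodule.span ℝ {outerNormal K p})ᗮ
    Matrix.det (Matrix.of fun i j => secondFundamentalForm K p (o i : E) (o j : E))
  else 0

/-- `∫_{∂K} √k / ⟨n,p⟩^((n-1)/2) · (2a/(1+a))^((n-1)/2) dA`, where `dA` is the Euclidean area, that
is, the Hausdorff measure of dimension `n - 1` with the Lebesgue normalization. -/
def centroProjAreaEuclid [FiniteDimensional ℝ E] [MeasurableSpace E] [BorelSpace E]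
    (K : Set E) : ENNReal :=
  ∫⁻ p in frontier K, ENNReal.ofReal
    (Real.sqrt (gaussCurvature K p)
      / inner ℝ (outerNormal K p) p ^ (((finrank ℝ E : ℝ) - 1) / 2)
      * (2 * antipodalFun K p / (1 + antipodalFun K p)) ^ (((finrank ℝ E : ℝ) - 1) / 2))
    ∂(μHE[finrank ℝ E - 1] : Measure E)

end Euclidean

end

/-!
The two integrals are compared in the central charts of a basis.

*Pointwise identity.* Let `F = gauge K` and let `F (p + v) = 1 + L v + B(v,v)/2 + o(|v|²)` at a
smooth boundary point `p`. On the tangent hyperplane `ker L` the function `G⁺ - 2` equals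
`2 (F - 1) / (1 + F ∘ (-·))`, and `F - 1` vanishes there to second order, so that the Hessian of
`G⁺` is `2a / (1 + a) • B` (`IsGaugeExpansion.isHessianOn_projGaugePlus`). Solving
`F (p + v - s n) = 1` for `s` shows that the second fundamental form is `⟨n, p⟩ • B`, because
`L n = 1 / ⟨n, p⟩` (`IsGaugeExpansion.isHessianOn_boundaryGraph`). Taking determinants in a frame
`v` and in an orthonormal frame of the tangent hyperplane, which differ by the Gram determinant of
`v`, the centro-projective density is the Euclidean integrand multiplied by the Euclidean area density
`√(det ⟨vᵢ, vⱼ⟩)` (`centroProjVolume_eq_sqrt_gram_mul`). Non-smooth points contribute zero to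
both sides, so Alexandroff's theorem is not needed.

*Integration.* A central chart is globally Lipschitz, and the central projection is a smooth left
inverse of it; hence it is differentiable almost everywhere, with injective derivatives. The area
formula for such parametrizations (`LipschitzWith.lintegral_range_eq_lintegral_gram`) is proved by
cutting the parameter space into countably many pieces on which the map is nearly linear; on each of
them the Hausdorff measures of the image and of the linear image are comparable up to a factor
arbitrarily close to one, and for linear maps the Jacobian is `LinearMap.normDet`. The two charts
cover the boundary up to its points in a coordinate hyperplane, which form a null set.

*Independence of the scalar product.* The intrinsic area of `T '' K` in the basis `b.map T` equals
that of `K` in the basis `b` (`centroProjArea_map`), so the integral formula for both bodies shows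
that the Euclidean expressions agree.
-/

/-! ### The area formula for maps between Euclidean spaces -/

section AreaFormula

open scoped NNReal ENNReal Pointwise
open Filter Set Metric

/-- Comparison of Hausdorff measures of two images of the same set: if `f` contracts distances
at least as much as `g` up to the factor `K`, the image under `f` is smaller up to `K ^ m`. -/
theorem euclideanHausdorffMeasure_image_le_of_edist_le {X Y Z : Type*}
    [EMetricSpace Y] [MeasurableSpace Y] [BorelSpace Y]
    [EMetricSpace Z] [MeasurableSpace Z] [BorelSpace Z]
    {f : X → Y} {g : X → Z} {s : Set X} {K : ℝ≥0}
    (h : ∀ x ∈ s, ∀ y ∈ s, edist (f x) (f y) ≤ K * edist (g x) (g y)) (m : ℕ) :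
    (μHE[m] : Measure Y) (f '' s) ≤ (K : ℝ≥0∞) ^ m * (μHE[m] : Measure Z) (g '' s) := by
  rcases s.eq_empty_or_nonempty with rfl | ⟨x₀, -⟩
  · simp
  have : Nonempty X := ⟨x₀⟩
  -- `f` factors on `s` through a `K`-Lipschitz map defined on `g '' s`
  have hinv : ∀ x ∈ s, Function.invFunOn g s (g x) ∈ s ∧
      g (Function.invFunOn g s (g x)) = g x := fun x hx =>
    Function.invFunOn_pos ⟨x, hx, rfl⟩
  have hl : LipschitzOnWith K (f ∘ Function.invFunOn g s) (g '' s) := by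
    rintro _ ⟨x, hx, rfl⟩ _ ⟨y, hy, rfl⟩
    have := h _ (hinv x hx).1 _ (hinv y hy).1
    rwa [(hinv x hx).2, (hinv y hy).2] at this
  have himg : f '' s = (f ∘ Function.invFunOn g s) '' (g '' s) := by
    rw [image_image]
    refine image_congr fun x hx => ?_
    have := h _ hx _ (hinv x hx).1
    rw [(hinv x hx).2, edist_self, mul_zero, nonpos_iff_eq_zero, edist_eq_zero] at this
    exact this
  have := hl.hausdorffMeasure_image_le (d := m) (Nat.cast_nonneg m)
  rw [himg, Measure.euclideanHausdorffMeasure_def, Measure.euclideanHausdorffMeasure_def,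
    Measure.smul_apply, Measure.smul_apply, mul_smul_comm]
  rw [ENNReal.rpow_natCast] at this
  gcongr

variable {U V : Type*} [NormedAddCommGroup U] [InnerProductSpace ℝ U] [FiniteDimensional ℝ U]
  [NormedAddCommGroup V] [InnerProductSpace ℝ V]

theorem normDet_le_of_norm_le [MeasurableSpace U] [BorelSpace U] [MeasurableSpace V] [BorelSpace V]
    {A B : U →ₗ[ℝ] V} {K : ℝ≥0} (h : ∀ v, ‖A v‖ ≤ K * ‖B v‖) :
    ENNReal.ofReal A.normDet ≤ (K : ℝ≥0∞) ^ finrank ℝ U * ENNReal.ofReal B.normDet := by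
  have h1 := euclideanHausdorffMeasure_image_le_of_edist_le (f := A) (g := B)
    (s := closedBall (0 : U) 1) (K := K) (fun x _ y _ => by
      rw [edist_eq_enorm_sub, edist_eq_enorm_sub, ← map_sub, ← map_sub]
      have : ‖A (x - y)‖₊ ≤ K * ‖B (x - y)‖₊ := h (x - y)
      rw [enorm_eq_nnnorm, enorm_eq_nnnorm]
      exact_mod_cast this) (finrank ℝ U)
  rw [A.euclideanHausdorffMeasure_image_eq_normDet_mul_volume,
    B.euclideanHausdorffMeasure_image_eq_normDet_mul_volume, ← mul_assoc] at h1
  exact (ENNReal.mul_le_mul_iff_left (measure_closedBall_pos _ _ one_pos).ne'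
    measure_closedBall_lt_top.ne).1 h1

theorem exists_mul_norm_le_mul_norm_apply (A : U →L[ℝ] V) {η : ℝ≥0} (hη : η ≠ 0) :
    ∃ δ : ℝ≥0, δ ≠ 0 ∧ (Function.Injective A → ∀ v, δ * ‖v‖ ≤ η * ‖A v‖) := by
  by_cases hA : Function.Injective A
  · obtain ⟨c, hc, h⟩ := (A : U →ₗ[ℝ] V).exists_antilipschitzWith (LinearMap.ker_eq_bot.2 hA)
    refine ⟨η / c, div_ne_zero hη hc.ne', fun _ v => ?_⟩
    have h1 : ‖v‖ ≤ c * ‖A v‖ := by simpa [dist_eq_norm] using h.le_mul_dist v 0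
    have hc' : (0 : ℝ) < c := hc
    rw [NNReal.coe_div, div_mul_eq_mul_div, div_le_iff₀ hc', mul_assoc, mul_comm ‖A v‖]
    gcongr
  · exact ⟨1, one_ne_zero, fun h => absurd h hA⟩

/-- At almost every point of a set where a differentiable map is within `δ` (in the Lipschitz sense)
of a linear map, the derivative is within `δ` of this linear map. This is the argument of
`ApproximatesLinearOn.norm_fderiv_sub_le`, for a target space of arbitrary dimension. -/
theorem ApproximatesLinearOn.ae_norm_fderiv_sub_le {E F : Type*} [NormedAddCommGroup E]
    [NormedSpace ℝ E] [FiniteDimensional ℝ E] [MeasurableSpace E] [BorelSpace E]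
    [NormedAddCommGroup F] [NormedSpace ℝ F] (μ : Measure E) [μ.IsAddHaarMeasure]
    {f : E → F} {s : Set E} {A : E →L[ℝ] F} {δ : ℝ≥0}
    (hf : ApproximatesLinearOn f A s δ) (hs : MeasurableSet s) {f' : E → E →L[ℝ] F}
    (hf' : ∀ x ∈ s, HasFDerivWithinAt f (f' x) s x) :
    ∀ᵐ x ∂μ.restrict s, ‖f' x - A‖ ≤ δ := by
  filter_upwards [Besicovitch.ae_tendsto_measure_inter_div μ s, ae_restrict_mem hs] with x hx xs
  refine ContinuousLinearMap.opNorm_le_bound _ δ.2 fun z => ?_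
  suffices H : ∀ ε, 0 < ε → ‖(f' x - A) z‖ ≤ (δ + ε) * (‖z‖ + ε) + ‖f' x - A‖ * ε by
    have : Tendsto (fun ε : ℝ => ((δ : ℝ) + ε) * (‖z‖ + ε) + ‖f' x - A‖ * ε) (𝓝[>] 0)
        (𝓝 ((δ + 0) * (‖z‖ + 0) + ‖f' x - A‖ * 0)) :=
      Tendsto.mono_left (Continuous.tendsto (by fun_prop) 0) nhdsWithin_le_nhds
    simp only [add_zero, mul_zero] at this
    exact le_of_tendsto_of_tendsto tendsto_const_nhds this
      (by filter_upwards [self_mem_nhdsWithin] using H)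
  intro ε εpos
  -- near a density point, `s` meets the small copies `x + r • closedBall z ε` of any ball
  have B₁ : ∀ᶠ r in 𝓝[>] (0 : ℝ), (s ∩ ({x} + r • closedBall z ε)).Nonempty :=
    Measure.eventually_nonempty_inter_smul_of_density_one μ s x hx _ measurableSet_closedBall
      (measure_closedBall_pos μ z εpos).ne'
  obtain ⟨ρ, ρpos, hρ⟩ :
      ∃ ρ > 0, ball x ρ ∩ s ⊆ {y : E | ‖f y - f x - (f' x) (y - x)‖ ≤ ε * ‖y - x‖} :=
    mem_nhdsWithin_iff.1 ((hf' x xs).isLittleO.def εpos)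
  have B₂ : ∀ᶠ r in 𝓝[>] (0 : ℝ), {x} + r • closedBall z ε ⊆ ball x ρ :=
    nhdsWithin_le_nhds
      (eventually_singleton_add_smul_subset isBounded_closedBall (ball_mem_nhds x ρpos))
  obtain ⟨r, ⟨y, ⟨ys, hy⟩⟩, rρ, rpos⟩ :
      ∃ r : ℝ, (s ∩ ({x} + r • closedBall z ε)).Nonempty ∧
        {x} + r • closedBall z ε ⊆ ball x ρ ∧ 0 < r :=
    (B₁.and (B₂.and self_mem_nhdsWithin)).exists
  obtain ⟨a, az, ya⟩ : ∃ a, a ∈ closedBall z ε ∧ y = x + r • a := by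
    simp only [mem_smul_set, image_add_left, mem_preimage, singleton_add] at hy
    rcases hy with ⟨a, az, ha⟩
    exact ⟨a, az, by simp only [ha, add_neg_cancel_left]⟩
  rw [mem_closedBall_iff_norm] at az
  have norm_a : ‖a‖ ≤ ‖z‖ + ε := by
    calc ‖a‖ = ‖z + (a - z)‖ := by rw [add_sub_cancel]
      _ ≤ ‖z‖ + ‖a - z‖ := norm_add_le _ _
      _ ≤ ‖z‖ + ε := by gcongr
  have hyx : y - x = r • a := by rw [ya, add_sub_cancel_left]
  -- compare the two linear approximations of `f y - f x`
  have I : r * ‖(f' x - A) a‖ ≤ r * ((δ + ε) * (‖z‖ + ε)) :=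
    calc
      r * ‖(f' x - A) a‖ = ‖(f' x - A) (r • a)‖ := by
        rw [map_smul, norm_smul, Real.norm_eq_abs, abs_of_pos rpos]
      _ = ‖f y - f x - A (y - x) - (f y - f x - (f' x) (y - x))‖ := by
        rw [hyx, sub_sub_sub_cancel_left, sub_apply]
      _ ≤ ‖f y - f x - A (y - x)‖ + ‖f y - f x - (f' x) (y - x)‖ := norm_sub_le _ _
      _ ≤ δ * ‖y - x‖ + ε * ‖y - x‖ := add_le_add (hf _ ys _ xs) (hρ ⟨rρ hy, ys⟩)
      _ = r * ((δ + ε) * ‖a‖) := by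
        rw [hyx, norm_smul, Real.norm_eq_abs, abs_of_pos rpos]
        ring
      _ ≤ r * ((δ + ε) * (‖z‖ + ε)) := by gcongr
  calc
    ‖(f' x - A) z‖ = ‖(f' x - A) a + (f' x - A) (z - a)‖ := by rw [← map_add, add_sub_cancel]
    _ ≤ ‖(f' x - A) a‖ + ‖(f' x - A) (z - a)‖ := norm_add_le _ _
    _ ≤ (δ + ε) * (‖z‖ + ε) + ‖f' x - A‖ * ‖z - a‖ :=
      add_le_add (le_of_mul_le_mul_left I rpos) (ContinuousLinearMap.le_opNorm _ _)
    _ ≤ (δ + ε) * (‖z‖ + ε) + ‖f' x - A‖ * ε := by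
      rw [norm_sub_rev] at az
      gcongr

/-- A relative error of at most `1 - K⁻¹` changes norms by a factor between `K⁻¹` and `K`. -/
theorem norm_le_mul_norm_of_norm_sub_le {V : Type*} [NormedAddCommGroup V] {K : ℝ≥0}
    (hK : 1 ≤ K) {a b : V}
    (h : ‖b - a‖ ≤ (1 - K⁻¹ : ℝ≥0) * ‖a‖) : ‖b‖ ≤ K * ‖a‖ ∧ ‖a‖ ≤ K * ‖b‖ := by
  have hK0 : (0 : ℝ) < K := zero_lt_one.trans_le (by exact_mod_cast hK)
  have hK1 : (1 : ℝ) ≤ K := by exact_mod_cast hK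
  have hi : (K : ℝ) * (K : ℝ)⁻¹ = 1 := mul_inv_cancel₀ hK0.ne'
  rw [NNReal.coe_sub (inv_le_one_of_one_le₀ hK), NNReal.coe_one, NNReal.coe_inv] at h
  have h1 : ‖b‖ ≤ ‖a‖ + ‖b - a‖ := by
    simpa using norm_add_le a (b - a)
  have h2 : ‖a‖ ≤ ‖b‖ + ‖b - a‖ := by
    simpa using norm_sub_le b (b - a)
  have ha := norm_nonneg a
  have hb := norm_nonneg b
  constructor
  · have h3 : 2 - (K : ℝ)⁻¹ ≤ K := by
      have : (K : ℝ)⁻¹ * (K - 1) ^ 2 ≥ 0 := by positivity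
      nlinarith
    nlinarith [mul_le_mul_of_nonneg_right h3 ha]
  · have h3 : (K : ℝ)⁻¹ * ‖a‖ ≤ ‖b‖ := by linarith
    calc ‖a‖ = K * ((K : ℝ)⁻¹ * ‖a‖) := by rw [← mul_assoc, hi, one_mul]
      _ ≤ K * ‖b‖ := by gcongr

theorem continuous_normDet : Continuous fun A : U →L[ℝ] V => (A : U →ₗ[ℝ] V).normDet := by
  have h : (fun A : U →L[ℝ] V => (A : U →ₗ[ℝ] V).normDet) =
      fun A => √(Matrix.gram ℝ fun i => A (stdOrthonormalBasis ℝ U i)).det := by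
    ext A
    have := (A : U →ₗ[ℝ] V).normDet_sq_eq_det_gram (stdOrthonormalBasis ℝ U)
    rw [RCLike.ofReal_real_eq_id, id] at this
    rw [← Real.sqrt_sq (LinearMap.normDet_nonneg _), this]
    rfl
  rw [h]
  refine Real.continuous_sqrt.comp (Continuous.matrix_det ?_)
  refine continuous_matrix fun i j => ?_
  simp only [Matrix.gram_apply]
  fun_prop

variable [MeasurableSpace U] [BorelSpace U] [MeasurableSpace V] [BorelSpace V]

/-- The two-sided area estimate up to a factor `K > 1`: the set is cut into countably many pieces on
which the map differs from an injective linear map by a small relative error. -/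
theorem lintegral_normDet_fderiv_comparable [FiniteDimensional ℝ V] {f : U → V} {s : Set U}
    (hs : MeasurableSet s) (hd : ∀ x ∈ s, DifferentiableAt ℝ f x)
    (hi : ∀ x ∈ s, Function.Injective (fderiv ℝ f x)) (hf : InjOn f s) {K : ℝ≥0} (hK : 1 < K) :
    ∫⁻ x in s, ENNReal.ofReal (fderiv ℝ f x : U →ₗ[ℝ] V).normDet ≤
        (K : ℝ≥0∞) ^ (2 * finrank ℝ U) * μHE[finrank ℝ U] (f '' s) ∧
      μHE[finrank ℝ U] (f '' s) ≤ (K : ℝ≥0∞) ^ (2 * finrank ℝ U) *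
        ∫⁻ x in s, ENNReal.ofReal (fderiv ℝ f x : U →ₗ[ℝ] V).normDet := by
  rcases s.eq_empty_or_nonempty with rfl | hne
  · simp
  have hη : 1 - K⁻¹ ≠ 0 := (tsub_pos_of_lt (inv_lt_one_of_one_lt₀ hK)).ne'
  choose δ hδ0 hδ using fun A : U →L[ℝ] V => exists_mul_norm_le_mul_norm_apply A hη
  obtain ⟨t, A, t_disj, t_meas, t_cover, ht, hA⟩ :=
    exists_partition_approximatesLinearOn_of_hasFDerivWithinAt f s (fderiv ℝ f)
      (fun x hx => (hd x hx).hasFDerivAt.hasFDerivWithinAt) δ hδ0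
  have hAi : ∀ n, Function.Injective (A n) := fun n => by
    obtain ⟨y, hy, h⟩ := hA hne n
    exact h ▸ hi y hy
  have hm : ∀ n, MeasurableSet (s ∩ t n) := fun n => hs.inter (t_meas n)
  have hs_eq : s = ⋃ n, s ∩ t n := by
    rw [← inter_iUnion, inter_eq_self_of_subset_left t_cover]
  have hdisj : Pairwise (Function.onFun Disjoint fun n => s ∩ t n) :=
    pairwise_disjoint_mono t_disj fun n => inter_subset_right
  have hcont : ContinuousOn f s := fun x hx => (hd x hx).continuousAt.continuousWithinAt
  -- the measure of the image of a piece is the sum of the measures of the images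
  have himg : μHE[finrank ℝ U] (f '' s) = ∑' n, μHE[finrank ℝ U] (f '' (s ∩ t n)) := by
    conv_lhs => rw [hs_eq, image_iUnion]
    refine measure_iUnion (fun i j hij => ?_) fun n => ?_
    · exact Disjoint.image (hdisj hij) hf inter_subset_left inter_subset_left
    · exact (hm n).image_of_continuousOn_injOn (hcont.mono inter_subset_left)
        (hf.mono inter_subset_left)
  have hint : ∫⁻ x in s, ENNReal.ofReal (fderiv ℝ f x : U →ₗ[ℝ] V).normDet =
      ∑' n, ∫⁻ x in s ∩ t n, ENNReal.ofReal (fderiv ℝ f x : U →ₗ[ℝ] V).normDet := by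
    conv_lhs => rw [hs_eq]
    exact lintegral_iUnion hm hdisj _
  have hlin : ∀ n, ∀ x ∈ s ∩ t n, ∀ y ∈ s ∩ t n,
      ‖f x - f y‖ ≤ K * ‖A n x - A n y‖ ∧ ‖A n x - A n y‖ ≤ K * ‖f x - f y‖ := by
    intro n x hx y hy
    refine norm_le_mul_norm_of_norm_sub_le hK.le ?_
    rw [← map_sub]
    exact (ht n x hx y hy).trans (hδ _ (hAi n) _)
  have hder : ∀ n, ∀ᵐ x ∂volume.restrict (s ∩ t n), ∀ v,
      ‖fderiv ℝ f x v‖ ≤ K * ‖A n v‖ ∧ ‖A n v‖ ≤ K * ‖fderiv ℝ f x v‖ := by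
    intro n
    filter_upwards [(ht n).ae_norm_fderiv_sub_le volume (hm n)
      fun x hx => (hd x hx.1).hasFDerivAt.hasFDerivWithinAt] with x hx v
    refine norm_le_mul_norm_of_norm_sub_le hK.le ?_
    rw [← sub_apply]
    exact ((ContinuousLinearMap.le_opNorm _ _).trans (by gcongr)).trans (hδ _ (hAi n) v)
  have hAimg : ∀ n, μHE[finrank ℝ U] (A n '' (s ∩ t n)) =
      ∫⁻ _ in s ∩ t n, ENNReal.ofReal (A n : U →ₗ[ℝ] V).normDet := fun n => by
    rw [setLIntegral_const]
    exact (A n : U →ₗ[ℝ] V).euclideanHausdorffMeasure_image_eq_normDet_mul_volume _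
  have hnn : ∀ {x y : V} {x' y' : V}, ‖x - y‖ ≤ K * ‖x' - y'‖ → edist x y ≤ K * edist x' y' := by
    intro x y x' y' h
    rw [edist_eq_enorm_sub, edist_eq_enorm_sub, enorm_eq_nnnorm, enorm_eq_nnnorm]
    exact_mod_cast (show ‖x - y‖₊ ≤ K * ‖x' - y'‖₊ from h)
  have hKtop : (K : ℝ≥0∞) ^ finrank ℝ U ≠ ∞ := by finiteness
  rw [himg, hint, two_mul, pow_add, ← ENNReal.tsum_mul_left, ← ENNReal.tsum_mul_left]
  constructor
  · refine ENNReal.tsum_le_tsum fun n => ?_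
    calc ∫⁻ x in s ∩ t n, ENNReal.ofReal (fderiv ℝ f x : U →ₗ[ℝ] V).normDet
        ≤ ∫⁻ _ in s ∩ t n, (K : ℝ≥0∞) ^ finrank ℝ U *
            ENNReal.ofReal (A n : U →ₗ[ℝ] V).normDet := by
          refine lintegral_mono_ae ?_
          filter_upwards [hder n] with x hx
          exact normDet_le_of_norm_le fun v => (hx v).1
      _ = (K : ℝ≥0∞) ^ finrank ℝ U * μHE[finrank ℝ U] (A n '' (s ∩ t n)) := by
          rw [lintegral_const_mul' _ _ hKtop, hAimg]
      _ ≤ _ := by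
          rw [mul_assoc]
          gcongr
          exact euclideanHausdorffMeasure_image_le_of_edist_le
            (fun x hx y hy => hnn (hlin n x hx y hy).2) _
  · refine ENNReal.tsum_le_tsum fun n => ?_
    calc μHE[finrank ℝ U] (f '' (s ∩ t n))
        ≤ (K : ℝ≥0∞) ^ finrank ℝ U * μHE[finrank ℝ U] (A n '' (s ∩ t n)) :=
          euclideanHausdorffMeasure_image_le_of_edist_le
            (fun x hx y hy => hnn (hlin n x hx y hy).1) _
      _ ≤ (K : ℝ≥0∞) ^ finrank ℝ U * ∫⁻ x in s ∩ t n, (K : ℝ≥0∞) ^ finrank ℝ U *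
            ENNReal.ofReal (fderiv ℝ f x : U →ₗ[ℝ] V).normDet := by
          rw [hAimg]
          gcongr 1
          refine lintegral_mono_ae ?_
          filter_upwards [hder n] with x hx
          exact normDet_le_of_norm_le fun v => (hx v).2
      _ = _ := by rw [lintegral_const_mul' _ _ hKtop, mul_assoc]

theorem ENNReal.le_of_forall_one_lt_pow_mul {a b : ℝ≥0∞} (k : ℕ)
    (h : ∀ K : ℝ≥0, 1 < K → a ≤ (K : ℝ≥0∞) ^ k * b) : a ≤ b := by
  have : Tendsto (fun K : ℝ≥0 => (K : ℝ≥0∞) ^ k * b) (𝓝[>] 1) (𝓝 (((1 : ℝ≥0) : ℝ≥0∞) ^ k * b)) := by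
    refine (ENNReal.Tendsto.mul_const ?_ (Or.inl (by simp))).mono_left nhdsWithin_le_nhds
    exact ((ENNReal.continuous_pow k).comp ENNReal.continuous_coe).tendsto 1
  simp only [ENNReal.coe_one, one_pow, one_mul] at this
  exact ge_of_tendsto this (by filter_upwards [self_mem_nhdsWithin] using h)

/-- **Area formula** for the image of a measurable set under an injective differentiable map with
injective derivatives. -/
theorem lintegral_normDet_fderiv_eq_euclideanHausdorffMeasure_image [FiniteDimensional ℝ V]
    {f : U → V} {s : Set U} (hs : MeasurableSet s) (hd : ∀ x ∈ s, DifferentiableAt ℝ f x)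
    (hi : ∀ x ∈ s, Function.Injective (fderiv ℝ f x)) (hf : InjOn f s) :
    ∫⁻ x in s, ENNReal.ofReal (fderiv ℝ f x : U →ₗ[ℝ] V).normDet =
      μHE[finrank ℝ U] (f '' s) :=
  le_antisymm
    (ENNReal.le_of_forall_one_lt_pow_mul _ fun _ hK =>
      (lintegral_normDet_fderiv_comparable hs hd hi hf hK).1)
    (ENNReal.le_of_forall_one_lt_pow_mul _ fun _ hK =>
      (lintegral_normDet_fderiv_comparable hs hd hi hf hK).2)

/-- **Area formula**, for the integral of an arbitrary (not necessarily measurable) function. -/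
theorem lintegral_image_eq_lintegral_normDet_fderiv_mul [FiniteDimensional ℝ V]
    {f : U → V} {s : Set U} (hs : MeasurableSet s) (hd : ∀ x ∈ s, DifferentiableAt ℝ f x)
    (hi : ∀ x ∈ s, Function.Injective (fderiv ℝ f x)) (hf : InjOn f s) (hfm : Measurable f)
    (g : V → ℝ≥0∞) :
    ∫⁻ p in f '' s, g p ∂(μHE[finrank ℝ U] : Measure V) =
      ∫⁻ x in s, ENNReal.ofReal (fderiv ℝ f x : U →ₗ[ℝ] V).normDet * g (f x) := by
  have hJ : Measurable fun x => ENNReal.ofReal (fderiv ℝ f x : U →ₗ[ℝ] V).normDet :=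
    ENNReal.measurable_ofReal.comp (continuous_normDet.measurable.comp (measurable_fderiv ℝ f))
  have hcont : ContinuousOn f s := fun x hx => (hd x hx).continuousAt.continuousWithinAt
  have hemb : MeasurableEmbedding (s.domRestrict f) := hcont.measurableEmbedding hs hf
  set ρ : Measure U := volume.withDensity
    fun x => ENNReal.ofReal (fderiv ℝ f x : U →ₗ[ℝ] V).normDet with hρ
  have hmap : Measure.map (s.domRestrict f) (ρ.comap (↑)) =
      (μHE[finrank ℝ U] : Measure V).restrict (f '' s) := by
    have hcomp : s.domRestrict f = f ∘ ((↑) : s → U) := rfl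
    rw [hcomp, ← Measure.map_map hfm measurable_subtype_coe, map_comap_subtype_coe hs, hρ,
      restrict_withDensity hs]
    refine Measure.ext fun A hA => ?_
    rw [Measure.map_apply hfm hA, withDensity_apply _ (hfm hA), Measure.restrict_apply hA,
      Measure.restrict_restrict (hfm hA), ← image_preimage_inter]
    exact lintegral_normDet_fderiv_eq_euclideanHausdorffMeasure_image ((hfm hA).inter hs)
      (fun x hx => hd x hx.2) (fun x hx => hi x hx.2) (hf.mono inter_subset_right)
  rw [← hmap, hemb.lintegral_map]
  simp only [Set.domRestrict_apply, ← Function.comp_apply (f := g)]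
  rw [← (MeasurableEmbedding.subtype_coe hs).lintegral_map, map_comap_subtype_coe hs,
    setLIntegral_withDensity_eq_setLIntegral_mul_non_measurable₀ _ _ _ hs]
  · simp only [Pi.mul_apply, Function.comp_apply]
  · simp
  · exact hJ.aemeasurable


/-- Lipschitz parametrizations by `ℝᵐ` map Lebesgue null sets to null sets for the `m`-dimensional
Hausdorff measure. -/
theorem LipschitzWith.euclideanHausdorffMeasure_image_eq_zero {V : Type*} [NormedAddCommGroup V]
    [MeasurableSpace V] [BorelSpace V] {m : ℕ} {f : (Fin m → ℝ) → V}
    {C : ℝ≥0} (hf : LipschitzWith C f) {N : Set (Fin m → ℝ)} (hN : volume N = 0) :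
    (μHE[m] : Measure V) (f '' N) = 0 := by
  have h := hf.hausdorffMeasure_image_le (d := m) (Nat.cast_nonneg m) N
  have h0 : μH[m] N = 0 := by
    have := hausdorffMeasure_pi_real (ι := Fin m)
    rw [Fintype.card_fin] at this
    rw [this, hN]
  rw [h0, mul_zero, nonpos_iff_eq_zero] at h
  rw [Measure.euclideanHausdorffMeasure_def, Measure.smul_apply, h, smul_zero]

/-- Area formula for a Lipschitz parametrization by `ℝᵐ`; the Jacobian is the square root of the
Gram determinant of the partial derivatives. By Rademacher's theorem the parametrization is
differentiable almost everywhere. -/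
theorem LipschitzWith.lintegral_range_eq_lintegral_gram [FiniteDimensional ℝ V] {m : ℕ}
    {f : (Fin m → ℝ) → V} {C : ℝ≥0} (hf : LipschitzWith C f) (hinj : Function.Injective f)
    (hi : ∀ u, DifferentiableAt ℝ f u → Function.Injective (fderiv ℝ f u)) (g : V → ℝ≥0∞) :
    ∫⁻ p in range f, g p ∂(μHE[m] : Measure V) =
      ∫⁻ u, ENNReal.ofReal
        √(Matrix.gram ℝ fun i => fderiv ℝ f u (Pi.single i 1)).det * g (f u) := by
  set D : Set (Fin m → ℝ) := {u | DifferentiableAt ℝ f u} with hD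
  have hDm : MeasurableSet D := measurableSet_of_differentiableAt ℝ f
  have hDae : ∀ᵐ u, u ∈ D := hf.ae_differentiableAt
  -- transport to Euclidean space, where the area formula is available
  let e : EuclideanSpace ℝ (Fin m) ≃L[ℝ] (Fin m → ℝ) := EuclideanSpace.equiv (Fin m) ℝ
  have he : MeasurePreserving e := PiLp.volume_preserving_ofLp (Fin m)
  have hemb : MeasurableEmbedding e := e.toHomeomorph.measurableEmbedding
  have hfd : ∀ x, DifferentiableAt ℝ f (e x) →
      HasFDerivAt (f ∘ e) ((fderiv ℝ f (e x)).comp (e : EuclideanSpace ℝ (Fin m) →L[ℝ] _)) x :=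
    fun x hx => hx.hasFDerivAt.comp x e.hasFDerivAt
  have key := lintegral_image_eq_lintegral_normDet_fderiv_mul (f := f ∘ e) (s := e ⁻¹' D)
    (hemb.measurable hDm) (fun x hx => (hfd x hx).differentiableAt)
    (fun x hx => by
      rw [(hfd x hx).fderiv]
      exact (hi _ hx).comp e.injective)
    (hinj.comp e.injective).injOn (hf.continuous.measurable.comp hemb.measurable) g
  rw [image_comp, image_preimage_eq _ e.surjective, finrank_euclideanSpace_fin] at key
  have hrange : (f '' D : Set V) =ᵐ[(μHE[m] : Measure V)] range f := by
    rw [← image_univ]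
    refine (ae_eq_set.2 ⟨?_, ?_⟩)
    · rw [sdiff_eq_bot_iff.2 (image_mono (subset_univ D))]
      exact measure_empty
    · refine measure_mono_null ?_ (hf.euclideanHausdorffMeasure_image_eq_zero
        (N := Dᶜ) (mem_ae_iff.1 hDae))
      rw [← image_sdiff hinj]
      exact image_mono fun u hu => hu.2
  rw [← setLIntegral_congr hrange, key, ← setLIntegral_univ (μ := volume)
    (fun u : Fin m → ℝ => _), ← setLIntegral_congr (ae_eq_univ.2 (mem_ae_iff.1 hDae)),
    ← he.setLIntegral_comp_preimage_emb hemb]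
  refine setLIntegral_congr_fun (hemb.measurable hDm) fun x hx => ?_
  simp only [Function.comp_apply]
  congr 2
  have h := (fderiv ℝ (f ∘ e) x : EuclideanSpace ℝ (Fin m) →ₗ[ℝ] V).normDet_sq_eq_det_gram
    (EuclideanSpace.basisFun (Fin m) ℝ)
  rw [RCLike.ofReal_real_eq_id, id] at h
  rw [← Real.sqrt_sq (LinearMap.normDet_nonneg _), h, (hfd x hx).fderiv]
  congr! 4 with i
  rw [EuclideanSpace.basisFun_apply]
  rfl

end AreaFormula

/-! ### Second order expansions of the Minkowski functional -/

section SecondOrder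

open Filter

/-- `L` and `B` are the first and second order terms of a quadratic approximation of the Minkowski
functional at `p`. -/
def IsGaugeExpansion {V : Type*} [NormedAddCommGroup V] [NormedSpace ℝ V]
    (K : Set V) (p : V) (L : V →L[ℝ] ℝ) (B : LinearMap.BilinForm ℝ V) : Prop :=
  B.IsSymm ∧
    (fun v => gauge K (p + v) - gauge K p - L v - (1 / 2) * B v v) =o[𝓝 0] fun v => ‖v‖ ^ 2

variable {V : Type*} [NormedAddCommGroup V] [NormedSpace ℝ V] {K : Set V} {p : V}
  {L : V →L[ℝ] ℝ} {B : LinearMap.BilinForm ℝ V}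

theorem IsPointedConvexBody.gauge_eq_one (hK : IsPointedConvexBody K) (hp : p ∈ frontier K) :
    gauge K p = 1 :=
  (gauge_eq_one_iff_mem_frontier hK.convex hK.mem_nhds).2 hp

theorem IsPointedConvexBody.gauge_le_one_iff (hK : IsPointedConvexBody K) {x : V} :
    gauge K x ≤ 1 ↔ x ∈ K := by
  rw [gauge_le_one_iff_mem_closure hK.convex hK.mem_nhds, hK.isCompact.isClosed.closure_eq]

theorem IsPointedConvexBody.ne_zero_of_mem_frontier (hK : IsPointedConvexBody K)
    (hp : p ∈ frontier K) : p ≠ 0 := by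
  rintro rfl
  exact hp.2 hK.zero_mem_interior

theorem LinearMap.BilinForm.exists_abs_apply_le [FiniteDimensional ℝ V]
    (B : LinearMap.BilinForm ℝ V) : ∃ C : ℝ, 0 ≤ C ∧ ∀ v w, |B v w| ≤ C * ‖v‖ * ‖w‖ := by
  let B' : V →L[ℝ] V →L[ℝ] ℝ := LinearMap.toContinuousLinearMap
    ((LinearMap.toContinuousLinearMap : (V →ₗ[ℝ] ℝ) ≃ₗ[ℝ] V →L[ℝ] ℝ).toLinearMap ∘ₗ B)
  exact ⟨‖B'‖, B'.opNorm_nonneg, fun v w => B'.le_opNorm₂ v w⟩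

theorem LinearMap.BilinForm.apply_self_isBigO [FiniteDimensional ℝ V]
    (B : LinearMap.BilinForm ℝ V) (l : Filter V) : (fun v => B v v) =O[l] fun v => ‖v‖ ^ 2 := by
  obtain ⟨C, -, hC⟩ := B.exists_abs_apply_le
  refine IsBigO.of_bound C (Eventually.of_forall fun v => ?_)
  rw [Real.norm_eq_abs, Real.norm_of_nonneg (by positivity), pow_two, ← mul_assoc]
  exact hC v v

theorem IsGaugeExpansion.hasFDerivAt [FiniteDimensional ℝ V] (h : IsGaugeExpansion K p L B) :
    HasFDerivAt (gauge K) L p := by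
  rw [hasFDerivAt_iff_isLittleO_nhds_zero]
  have hsq : (fun v : V => ‖v‖ ^ 2) =o[𝓝 0] fun v => v := by
    simpa using isLittleO_norm_pow_id (E' := V) one_lt_two
  have h2 := (h.2.trans hsq).add
    (((B.apply_self_isBigO (𝓝 0)).const_mul_left (1 / 2)).trans_isLittleO hsq)
  refine h2.congr_left fun v => ?_
  ring

theorem boundaryTangent_eq_ker (hL : HasFDerivAt (gauge K) L p) :
    boundaryTangent K p = L.toLinearMap.ker := by
  rw [boundaryTangent, hL.fderiv]

/-- Euler's relation for the Minkowski functional. -/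
theorem HasFDerivAt.gauge_apply_self (hL : HasFDerivAt (gauge K) L p) : L p = gauge K p := by
  have h1 : HasDerivAt (fun t : ℝ => gauge K (t • p)) (L p) 1 := by
    have h2 : HasDerivAt (fun t : ℝ => t • p) ((1 : ℝ) • p) 1 := (hasDerivAt_id _).smul_const p
    rw [one_smul] at h2
    have hL' : HasFDerivAt (gauge K) L ((1 : ℝ) • p) := by rwa [one_smul]
    exact hL'.comp_hasDerivAt _ h2
  have h3 : HasDerivAt (fun t : ℝ => t * gauge K p) (1 * gauge K p) 1 :=
    (hasDerivAt_id _).mul_const _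
  rw [one_mul] at h3
  refine h1.unique (h3.congr_of_eventuallyEq ?_)
  filter_upwards [lt_mem_nhds (zero_lt_one : (0 : ℝ) < 1)] with t ht
  rw [gauge_smul_of_nonneg ht.le, smul_eq_mul]

theorem projGaugePlus_eq (hK : IsPointedConvexBody K) {x : V} (hx : x ≠ 0) :
    projGaugePlus K x = 2 * (gauge K x + gauge K (-x)) / (1 + gauge K (-x)) := by
  have h1 := hK.gauge_pos hx
  have h2 := hK.gauge_pos (neg_ne_zero.2 hx)
  have h3 : 1 + gauge K (-x) ≠ 0 := by positivity
  have e1 : 1 - -(gauge K (-x))⁻¹ = (1 + gauge K (-x)) / gauge K (-x) := by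
    field_simp
    ring
  have e2 : (gauge K x)⁻¹ - -(gauge K (-x))⁻¹ =
      (gauge K x + gauge K (-x)) / (gauge K x * gauge K (-x)) := by
    field_simp
    ring
  simp only [projGaugePlus, e1, e2, sub_zero, one_mul]
  field_simp

theorem two_mul_antipodalFun_div (hK : IsPointedConvexBody K) (hp : p ∈ frontier K) :
    2 * antipodalFun K p / (1 + antipodalFun K p) = 2 / (1 + gauge K (-p)) := by
  have h2 := hK.gauge_pos (neg_ne_zero.2 (hK.ne_zero_of_mem_frontier hp))
  have h3 : 1 + gauge K (-p) ≠ 0 := by positivity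
  rw [antipodalFun]
  field_simp
  ring

/-- The Hessian of the projective gauge function on the tangent hyperplane is the Hessian of the
Minkowski functional, multiplied by the positive function `2a / (1 + a)`: on the tangent hyperplane
`G⁺ - 2 = 2 (F - 1) / (1 + F ∘ (-·))`, and `F - 1` vanishes to second order. -/
theorem IsGaugeExpansion.isHessianOn_projGaugePlus [FiniteDimensional ℝ V]
    (hK : IsPointedConvexBody K) (hp : p ∈ frontier K) (h : IsGaugeExpansion K p L B) :
    IsHessianOn (fun v => projGaugePlus K (p + v)) L.toLinearMap.ker
      ((2 * antipodalFun K p / (1 + antipodalFun K p)) • B) := by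
  refine ⟨⟨fun v w => ?_⟩, ?_⟩
  · simp only [LinearMap.smul_apply]
    rw [h.1.eq v w]
  rw [two_mul_antipodalFun_div hK hp]
  have hp0 := hK.ne_zero_of_mem_frontier hp
  set q : V → ℝ := fun v => 2 / (1 + gauge K (-(p + v))) with hq
  have hqc : Tendsto q (𝓝 0) (𝓝 (q 0)) := by
    refine ContinuousAt.tendsto (continuousAt_const.div ?_ ?_)
    · exact (continuous_const.add ((continuous_gauge hK.convex hK.mem_nhds).comp
        (by fun_prop))).continuousAt
    · have := gauge_nonneg (s := K) (-(p + 0))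
      positivity
  have hq0 : q 0 = 2 / (1 + gauge K (-p)) := by simp [hq]
  have e1 : (fun v => q v * (gauge K (p + v) - gauge K p - L v - (1 / 2) * B v v)) =o[𝓝 0]
      fun v => ‖v‖ ^ 2 := by
    simpa using (hqc.isBigO_one ℝ).mul_isLittleO h.2
  have e2 : (fun v => (q v - q 0) * (1 / 2 * B v v)) =o[𝓝 0] fun v => ‖v‖ ^ 2 := by
    have h1 : (fun v => q v - q 0) =o[𝓝 0] fun _ => (1 : ℝ) := by
      rw [isLittleO_one_iff]
      simpa using hqc.sub_const (q 0)
    simpa using h1.mul_isBigO ((B.apply_self_isBigO (𝓝 0)).const_mul_left (1 / 2))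
  refine ((e1.add e2).mono (nhdsWithin_le_nhds (s := (L.toLinearMap.ker : Set V)))).congr' ?_
    EventuallyEq.rfl
  have hne : ∀ᶠ v in 𝓝[(L.toLinearMap.ker : Set V)] (0 : V), p + v ≠ 0 := by
    refine nhdsWithin_le_nhds (ContinuousAt.eventually_ne (by fun_prop) ?_)
    simpa using hp0
  filter_upwards [self_mem_nhdsWithin, hne] with v hv hv0
  have hLv : L v = 0 := hv
  rw [add_zero, (projGauge_eq_of_mem_frontier hK hp).1, projGaugePlus_eq hK hv0, hLv,
    hK.gauge_eq_one hp, LinearMap.smul_apply, LinearMap.smul_apply, smul_eq_mul, ← hq0]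
  have h3 : 1 + gauge K (-(p + v)) ≠ 0 := by
    have := gauge_nonneg (s := K) (-(p + v))
    positivity
  have h4 : 2 * (gauge K (p + v) + gauge K (-(p + v))) / (1 + gauge K (-(p + v))) - 2 =
      q v * (gauge K (p + v) - 1) := by
    simp only [hq]
    field_simp
    ring
  rw [h4]
  ring

theorem hessianOn_apply {g : V → ℝ} {T : Submodule ℝ V} (h : IsHessianOn g T B) {v w : V}
    (hv : v ∈ T) (hw : w ∈ T) : hessianOn g T v w = B v w := by
  have hex : ∃ B, IsHessianOn g T B := ⟨B, h⟩
  rw [hessianOn, dif_pos hex]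
  exact hex.choose_spec.unique h hv hw

theorem IsGaugeExpansion.centroProjForm_apply [FiniteDimensional ℝ V]
    (hK : IsPointedConvexBody K) (hp : p ∈ frontier K) (h : IsGaugeExpansion K p L B) {v w : V}
    (hv : L v = 0) (hw : L w = 0) :
    centroProjForm K p v w = 2 * antipodalFun K p / (1 + antipodalFun K p) * B v w := by
  rw [centroProjForm, if_pos ⟨hp, L, B, h⟩, boundaryTangent_eq_ker h.hasFDerivAt,
    hessianOn_apply (h.isHessianOn_projGaugePlus hK hp) hv hw, LinearMap.smul_apply,
    LinearMap.smul_apply, smul_eq_mul]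

theorem IsGaugeExpansion.centroProjVolume_eq [FiniteDimensional ℝ V]
    (hK : IsPointedConvexBody K) (hp : p ∈ frontier K) (hexp : IsGaugeExpansion K p L B)
    {m : ℕ} {v : Fin m → V} (hv : ∀ i, L (v i) = 0) :
    centroProjVolume K p v = √((2 * antipodalFun K p / (1 + antipodalFun K p)) ^ m *
      (Matrix.of fun i j => B (v i) (v j)).det) := by
  have h : (Matrix.of fun i j => centroProjForm K p (v i) (v j)) =
      (2 * antipodalFun K p / (1 + antipodalFun K p)) • Matrix.of fun i j => B (v i) (v j) := by
    ext i j
    rw [Matrix.of_apply, hexp.centroProjForm_apply hK hp (hv i) (hv j)]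
    rfl
  rw [centroProjVolume, h, Matrix.det_smul, Fintype.card_fin]

/-- In dimension one every boundary point is smooth, since the Minkowski functional is linear on
rays. -/
theorem isSmoothBoundaryPoint_of_finrank_eq_one (hV : finrank ℝ V = 1)
    (hK : IsPointedConvexBody K) (hp : p ∈ frontier K) : IsSmoothBoundaryPoint K p := by
  have : FiniteDimensional ℝ V := .of_finrank_pos (by omega)
  have hp0 := hK.ne_zero_of_mem_frontier hp
  obtain ⟨ℓ, hℓ⟩ := SeparatingDual.exists_eq_one (R := ℝ) hp0
  have hspan : ∀ v, v = ℓ v • p := fun v => by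
    obtain ⟨c, rfl⟩ := (finrank_eq_one_iff_of_nonzero' p hp0).1 hV v
    rw [map_smul, hℓ, smul_eq_mul, mul_one]
  refine ⟨hp, ℓ, 0, ⟨fun _ _ => rfl⟩, ?_⟩
  refine (isLittleO_zero _ _).congr' ?_ EventuallyEq.rfl
  have hev : ∀ᶠ v in 𝓝 (0 : V), -1 < ℓ v :=
    ℓ.continuous.continuousAt.eventually_const_lt (by simp)
  filter_upwards [hev] with v hv
  have : p + v = (1 + ℓ v) • p := by
    conv_lhs => rw [hspan v]
    rw [add_smul, one_smul]
  rw [this, gauge_smul_of_nonneg (by linarith), hK.gauge_eq_one hp]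
  simp

end SecondOrder

/-! ### The normal vector and the second fundamental form -/

section Normal

open Filter

variable {E : Type*} [NormedAddCommGroup E] [InnerProductSpace ℝ E] {K : Set E} {p ν : E}
  {L : E →L[ℝ] ℝ} {B : LinearMap.BilinForm ℝ E}

/-- At a point of differentiability of the Minkowski functional, an outer unit normal vector is
dual to the differential, with factor the support number `⟨ν, p⟩`. -/
theorem IsOuterUnitNormal.inner_eq (hK : IsPointedConvexBody K) (hp : p ∈ frontier K)
    (hL : HasFDerivAt (gauge K) L p) (hν : IsOuterUnitNormal K p ν) :
    0 < inner ℝ ν p ∧ ∀ v, inner ℝ ν v = inner ℝ ν p * L v := by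
  have hg := hK.gauge_eq_one hp
  have hLp : L p = 1 := hL.gauge_apply_self.trans hg
  -- directions of descent of the Minkowski functional point into `K`
  have hneg : ∀ v, L v < 0 → inner ℝ ν v ≤ 0 := by
    intro v hv
    have h1 : HasDerivAt (fun t : ℝ => gauge K (p + t • v)) (L v) 0 := by
      have h2 : HasDerivAt (fun t : ℝ => p + t • v) ((1 : ℝ) • v) 0 :=
        ((hasDerivAt_id _).smul_const v).const_add p
      rw [one_smul] at h2
      have hL' : HasFDerivAt (gauge K) L (p + (0 : ℝ) • v) := by simpa using hL
      exact hL'.comp_hasDerivAt _ h2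
    have h3 : ∀ᶠ t in 𝓝[>] (0 : ℝ), slope (fun t : ℝ => gauge K (p + t • v)) 0 t < 0 :=
      ((hasDerivAt_iff_tendsto_slope.1 h1).mono_left
        (nhdsWithin_mono _ fun t (ht : 0 < t) => ht.ne')).eventually_lt_const hv
    obtain ⟨t, ht, ht0⟩ := (h3.and self_mem_nhdsWithin).exists
    have ht0 : 0 < t := ht0
    rw [slope_def_field, sub_zero, zero_smul, add_zero, hg] at ht
    have h5 : gauge K (p + t • v) ≤ 1 := by
      rcases div_neg_iff.1 ht with h | h <;> linarith
    have h6 := hν.2 _ (hK.gauge_le_one_iff.1 h5)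
    rw [add_sub_cancel_left, inner_smul_right] at h6
    exact nonpos_of_mul_nonpos_right h6 ht0
  have hker' : ∀ v, L v = 0 → inner ℝ ν v ≤ 0 := by
    intro v hv
    have h1 : Tendsto (fun s : ℝ => inner ℝ ν (v - s • p)) (𝓝[>] 0) (𝓝 (inner ℝ ν v)) := by
      have : Continuous fun s : ℝ => inner ℝ ν (v - s • p) := by fun_prop
      simpa using (this.tendsto 0).mono_left nhdsWithin_le_nhds
    refine le_of_tendsto h1 ?_
    filter_upwards [self_mem_nhdsWithin] with s hs
    refine hneg _ ?_
    rw [map_sub, map_smul, hv, hLp]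
    simpa using hs
  have hker : ∀ v, L v = 0 → inner ℝ ν v = 0 := fun v hv =>
    le_antisymm (hker' v hv) (by
      have := hker' (-v) (by rw [map_neg, hv, neg_zero])
      rw [inner_neg_right] at this
      linarith)
  have hmul : ∀ v, inner ℝ ν v = inner ℝ ν p * L v := by
    intro v
    have := hker (v - L v • p) (by rw [map_sub, map_smul, hLp, smul_eq_mul, mul_one, sub_self])
    rw [inner_sub_right, inner_smul_right] at this
    linarith
  refine ⟨lt_of_le_of_ne ?_ fun h0 => ?_, hmul⟩
  · have := hν.2 0 (interior_subset hK.zero_mem_interior)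
    rw [zero_sub, inner_neg_right] at this
    linarith
  · have h1 := hmul ν
    rw [← h0, zero_mul, inner_self_eq_zero] at h1
    have := hν.1
    rw [h1, norm_zero] at this
    exact zero_ne_one this

theorem exists_isOuterUnitNormal [CompleteSpace E] (hK : IsPointedConvexBody K)
    (hp : p ∈ frontier K) (hL : HasFDerivAt (gauge K) L p) : ∃ ν, IsOuterUnitNormal K p ν := by
  have hg := hK.gauge_eq_one hp
  have hLp : L p = 1 := hL.gauge_apply_self.trans hg
  set w := (InnerProductSpace.toDual ℝ E).symm L with hw
  have hwL : ∀ v, inner ℝ w v = L v := fun v => InnerProductSpace.toDual_symm_apply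
  have hw0 : w ≠ 0 := by
    intro h0
    have := hwL p
    rw [h0, inner_zero_left, hLp] at this
    exact zero_ne_one this
  have hwn : 0 < ‖w‖ := norm_pos_iff.2 hw0
  refine ⟨‖w‖⁻¹ • w, by rw [norm_smul, norm_inv, norm_norm, inv_mul_cancel₀ hwn.ne'], ?_⟩
  intro x hx
  rw [real_inner_smul_left, hwL]
  refine mul_nonpos_of_nonneg_of_nonpos (inv_nonneg.2 hwn.le) ?_
  have h1 : HasDerivAt (fun t : ℝ => gauge K (p + t • (x - p))) (L (x - p)) 0 := by
    have h2 : HasDerivAt (fun t : ℝ => p + t • (x - p)) ((1 : ℝ) • (x - p)) 0 :=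
      ((hasDerivAt_id _).smul_const _).const_add p
    rw [one_smul] at h2
    have hL' : HasFDerivAt (gauge K) L (p + (0 : ℝ) • (x - p)) := by simpa using hL
    exact hL'.comp_hasDerivAt _ h2
  have hmono : 𝓝[>] (0 : ℝ) ≤ 𝓝[≠] 0 := nhdsWithin_mono _ fun t ht => ne_of_gt ht
  refine le_of_tendsto ((hasDerivAt_iff_tendsto_slope.1 h1).mono_left hmono) ?_
  filter_upwards [Ioo_mem_nhdsGT (zero_lt_one : (0 : ℝ) < 1)] with t ht
  rw [slope_def_field, sub_zero, zero_smul, add_zero, hg]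
  refine div_nonpos_of_nonpos_of_nonneg (sub_nonpos.2 ?_) ht.1.le
  refine hK.gauge_le_one_iff.2 ?_
  exact hK.convex.add_smul_sub_mem (hK.isCompact.isClosed.frontier_subset hp) hx ⟨ht.1.le, ht.2.le⟩

theorem isOuterUnitNormal_outerNormal [CompleteSpace E] (hK : IsPointedConvexBody K)
    (hp : p ∈ frontier K) (hL : HasFDerivAt (gauge K) L p) :
    IsOuterUnitNormal K p (outerNormal K p) := by
  have h := exists_isOuterUnitNormal hK hp hL
  rw [outerNormal, dif_pos h]
  exact h.choose_spec

/-- The expansion of the Minkowski functional along points `p + v - s n` with `v` tangent and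
`s = O(|v|²)`, where `h = ⟨n, p⟩`. -/
theorem IsGaugeExpansion.eventually_abs_gauge_sub_le [FiniteDimensional ℝ E]
    (hexp : IsGaugeExpansion K p L B) (hg : gauge K p = 1) (n : E) (hn : ‖n‖ = 1) {ε M : ℝ}
    (hε : 0 < ε) (hM : 0 ≤ M) :
    ∀ᶠ v in 𝓝 (0 : E), L v = 0 → ∀ s : ℝ, |s| ≤ M * ‖v‖ ^ 2 →
      |gauge K (p + v - s • n) - 1 + s * L n - 1 / 2 * B v v| ≤ ε * ‖v‖ ^ 2 := by
  obtain ⟨C, hC0, hC⟩ := B.exists_abs_apply_le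
  -- half of `ε` goes to the remainder at `v - s n`, whose norm is at most `(1 + M) ‖v‖`, and half to
  -- the difference of `B` at `v - s n` and at `v`, which is of third order
  set c : ℝ := ε / (2 * (1 + M) ^ 2) with hc
  have hc0 : 0 < c := by positivity
  have hev := hexp.2.def hc0
  obtain ⟨δ, hδ, hball⟩ := Metric.eventually_nhds_iff.1 hev
  have h1 : ∀ᶠ v in 𝓝 (0 : E), (1 + M) * ‖v‖ < δ :=
    Tendsto.eventually_lt_const (by simpa using hδ) (Continuous.tendsto (by fun_prop) 0)
  have h2 : ∀ᶠ v in 𝓝 (0 : E), ‖v‖ < 1 :=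
    Tendsto.eventually_lt_const (by simp) (Continuous.tendsto (by fun_prop) 0)
  have h3 : ∀ᶠ v in 𝓝 (0 : E), (C * M + C * M ^ 2) * ‖v‖ < ε / 2 :=
    Tendsto.eventually_lt_const (by simpa using hε) (Continuous.tendsto (by fun_prop) 0)
  filter_upwards [h1, h2, h3] with v hv1 hv2 hv3 hLv s hs
  have hv0 := norm_nonneg v
  have hsq : ‖v‖ ^ 2 ≤ ‖v‖ := by nlinarith
  have hsv : |s| ≤ M * ‖v‖ := hs.trans (by gcongr)
  have hw : ‖v - s • n‖ ≤ (1 + M) * ‖v‖ := by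
    calc ‖v - s • n‖ ≤ ‖v‖ + ‖s • n‖ := norm_sub_le _ _
      _ = ‖v‖ + |s| := by rw [norm_smul, hn, mul_one, Real.norm_eq_abs]
      _ ≤ (1 + M) * ‖v‖ := by linarith
  have hmain := @hball (v - s • n) (by rw [dist_zero_right]; exact hw.trans_lt hv1)
  rw [Real.norm_eq_abs, Real.norm_of_nonneg (by positivity), hg, map_sub, map_smul, hLv,
    ← add_sub_assoc, smul_eq_mul] at hmain
  have hcw : c * ‖v - s • n‖ ^ 2 ≤ ε / 2 * ‖v‖ ^ 2 := by
    calc c * ‖v - s • n‖ ^ 2 ≤ c * ((1 + M) * ‖v‖) ^ 2 := by gcongr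
      _ = ε / 2 * ‖v‖ ^ 2 := by
        rw [hc]
        field_simp
  have hB : B (v - s • n) (v - s • n) = B v v - 2 * s * B v n + s ^ 2 * B n n := by
    have := hexp.1.eq v n
    simp only [map_sub, map_smul, LinearMap.sub_apply, LinearMap.smul_apply, smul_eq_mul] at this ⊢
    rw [← this]
    ring
  have hvn : |s * B v n| ≤ (M * ‖v‖ ^ 2) * (C * ‖v‖) := by
    rw [abs_mul]
    have := hC v n
    rw [hn, mul_one] at this
    gcongr
  have hnn : |s ^ 2 * B n n| ≤ (M * ‖v‖ ^ 2) ^ 2 * C := by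
    rw [abs_mul, abs_pow]
    have := hC n n
    rw [hn, mul_one, mul_one] at this
    gcongr
  have hfin : (M * ‖v‖ ^ 2) * (C * ‖v‖) + 1 / 2 * ((M * ‖v‖ ^ 2) ^ 2 * C) ≤ ε / 2 * ‖v‖ ^ 2 := by
    calc (M * ‖v‖ ^ 2) * (C * ‖v‖) + 1 / 2 * ((M * ‖v‖ ^ 2) ^ 2 * C)
        = ((C * M) * ‖v‖ + 1 / 2 * (C * M ^ 2) * ‖v‖ ^ 2) * ‖v‖ ^ 2 := by ring
      _ ≤ ((C * M) * ‖v‖ + 1 * (C * M ^ 2) * ‖v‖) * ‖v‖ ^ 2 := by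
        gcongr
        norm_num
      _ = ((C * M + C * M ^ 2) * ‖v‖) * ‖v‖ ^ 2 := by ring
      _ ≤ ε / 2 * ‖v‖ ^ 2 := by gcongr
  rw [hB] at hmain
  rw [abs_le] at hmain hvn hnn ⊢
  constructor <;> linarith [hmain.1, hmain.2, hvn.1, hvn.2, hnn.1, hnn.2]

/-- The second fundamental form is the Hessian of the Minkowski functional multiplied by the support
number `⟨n, p⟩`. -/
theorem IsGaugeExpansion.isHessianOn_boundaryGraph [FiniteDimensional ℝ E]
    (hK : IsPointedConvexBody K) (hp : p ∈ frontier K) (hexp : IsGaugeExpansion K p L B) :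
    IsHessianOn (boundaryGraph K p) (Submodule.span ℝ {outerNormal K p})ᗮ
      ((inner ℝ (outerNormal K p) p : ℝ) • B) := by
  have hν := isOuterUnitNormal_outerNormal hK hp hexp.hasFDerivAt
  obtain ⟨h0, hL⟩ := hν.inner_eq hK hp hexp.hasFDerivAt
  have hg := hK.gauge_eq_one hp
  have hpK : p ∈ K := hK.isCompact.isClosed.frontier_subset hp
  set n := outerNormal K p with hn
  set h : ℝ := inner ℝ n p with hh
  have hLn : h * L n = 1 := by
    rw [← hL, real_inner_self_eq_norm_sq, hν.1, one_pow]
  have hLn0 : 0 < L n := pos_of_mul_pos_right (hLn.symm ▸ zero_lt_one) h0.le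
  -- `K` lies on the inner side of the tangent hyperplane
  have hnonneg : ∀ v, inner ℝ n v = 0 → ∀ s : ℝ, p + v - s • n ∈ K → 0 ≤ s := by
    intro v hv s hs
    have := hν.2 _ hs
    rw [show p + v - s • n - p = v - s • n by abel, inner_sub_right, inner_smul_right, hv,
      real_inner_self_eq_norm_sq, hν.1] at this
    linarith
  refine ⟨⟨fun v w => ?_⟩, ?_⟩
  · simp only [LinearMap.smul_apply]
    rw [hexp.1.eq v w]
  have hzero : boundaryGraph K p 0 = 0 := by
    refine le_antisymm (csInf_le ⟨0, fun s hs => hnonneg 0 (inner_zero_right _) s hs⟩ ?_)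
      (le_csInf ⟨0, ?_⟩ fun s hs => hnonneg 0 (inner_zero_right _) s hs)
    all_goals simpa using hpK
  rw [hzero]
  obtain ⟨C, hC0, hC⟩ := B.exists_abs_apply_le
  refine IsLittleO.of_bound fun ε hε => ?_
  -- `s = h/2 B(v,v) ± ε |v|²` changes `F` by `∓ ε (L n) |v|²`, which absorbs the remainder
  have hev := hexp.eventually_abs_gauge_sub_le hg n hν.1 (ε := ε * L n) (M := h / 2 * C + ε)
    (by positivity) (by positivity)
  filter_upwards [nhdsWithin_le_nhds hev, self_mem_nhdsWithin] with v hv hvT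
  have hnv : inner ℝ n v = 0 := by
    have := (Submodule.mem_orthogonal_singleton_iff_inner_right).1 hvT
    exact this
  have hLv : L v = 0 := by
    have := hL v
    rw [hnv] at this
    exact (mul_eq_zero.1 this.symm).resolve_left h0.ne'
  have hBv : |B v v| ≤ C * ‖v‖ ^ 2 := by
    have := hC v v
    rwa [mul_assoc, ← pow_two] at this
  rw [abs_le] at hBv
  have hv' := hv hLv
  have hupper : p + v - (h / 2 * B v v + ε * ‖v‖ ^ 2) • n ∈ K := by
    refine hK.gauge_le_one_iff.1 ?_
    have := (abs_le.1 (hv' (h / 2 * B v v + ε * ‖v‖ ^ 2) ?_)).2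
    · have e : (h / 2 * B v v + ε * ‖v‖ ^ 2) * L n =
          1 / 2 * B v v * (h * L n) + ε * ‖v‖ ^ 2 * L n := by ring
      rw [e, hLn] at this
      linarith
    · rw [abs_le]
      constructor <;> nlinarith [hBv.1, hBv.2, sq_nonneg ‖v‖]
  have hlower : ∀ s, p + v - s • n ∈ K → h / 2 * B v v - ε * ‖v‖ ^ 2 ≤ s := by
    intro s hs
    by_contra! hlt
    have hs0 := hnonneg v hnv s hs
    have := (abs_le.1 (hv' s ?_)).1
    · have h1 := hK.gauge_le_one_iff.2 hs
      have h2 : s * L n < (h / 2 * B v v - ε * ‖v‖ ^ 2) * L n := by gcongr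
      have e : (h / 2 * B v v - ε * ‖v‖ ^ 2) * L n =
          1 / 2 * B v v * (h * L n) - ε * ‖v‖ ^ 2 * L n := by ring
      rw [e, hLn] at h2
      linarith
    · rw [abs_le]
      constructor <;> nlinarith [hBv.1, hBv.2, sq_nonneg ‖v‖]
  have hle : boundaryGraph K p v ≤ h / 2 * B v v + ε * ‖v‖ ^ 2 :=
    csInf_le ⟨0, fun s hs => hnonneg v hnv s hs⟩ hupper
  have hge : h / 2 * B v v - ε * ‖v‖ ^ 2 ≤ boundaryGraph K p v :=
    le_csInf ⟨_, hupper⟩ hlower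
  rw [Real.norm_eq_abs, Real.norm_of_nonneg (by positivity), LinearMap.smul_apply,
    LinearMap.smul_apply, smul_eq_mul, abs_le]
  constructor <;> linarith

end Normal

/-! ### The centro-projective density in Euclidean terms -/

section PointwiseIdentity

variable {E : Type*} [NormedAddCommGroup E] [InnerProductSpace ℝ E] {K : Set E} {p : E}
  {L : E →L[ℝ] ℝ} {B : LinearMap.BilinForm ℝ E} {m : ℕ}

/-- Change of basis for the determinant of the matrix of a bilinear form on a subspace. -/
theorem det_bilinForm_apply_eq_sq_mul {W : Submodule ℝ E} (o : OrthonormalBasis (Fin m) ℝ W)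
    (B : LinearMap.BilinForm ℝ E) {v : Fin m → E} (hv : ∀ i, v i ∈ W) :
    (Matrix.of fun i j => B (v i) (v j)).det =
      (Matrix.of fun i k => inner ℝ (o k : E) (v i)).det ^ 2 *
        (Matrix.of fun i j => B (o i) (o j)).det := by
  set P : Matrix (Fin m) (Fin m) ℝ := Matrix.of fun i k => inner ℝ (o k : E) (v i) with hP
  have hsum : ∀ i, v i = ∑ k, P i k • (o k : E) := fun i => by
    have := congrArg (Subtype.val : W → E) (o.sum_repr' ⟨v i, hv i⟩)
    rw [Submodule.coe_sum] at this
    exact this.symm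
  have hmat : (Matrix.of fun i j => B (v i) (v j)) =
      P * (Matrix.of fun i j => B (o i) (o j)) * P.transpose := by
    ext i j
    rw [Matrix.of_apply, hsum i, hsum j]
    simp only [map_sum, map_smul, LinearMap.sum_apply, LinearMap.smul_apply, smul_eq_mul,
      Matrix.mul_apply, Matrix.of_apply, Matrix.transpose_apply, Finset.sum_mul, Finset.mul_sum]
    refine Finset.sum_congr rfl fun k _ => Finset.sum_congr rfl fun l _ => ?_
    ring
  rw [hmat, Matrix.det_mul, Matrix.det_mul, Matrix.det_transpose]
  ring

theorem det_bilinForm_apply_eq_gram_mul {W : Submodule ℝ E} (o : OrthonormalBasis (Fin m) ℝ W)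
    (B : LinearMap.BilinForm ℝ E) {v : Fin m → E} (hv : ∀ i, v i ∈ W) :
    (Matrix.of fun i j => B (v i) (v j)).det =
      (Matrix.gram ℝ v).det * (Matrix.of fun i j => B (o i) (o j)).det := by
  have h1 := det_bilinForm_apply_eq_sq_mul o (innerₗ E) hv
  have h2 : (Matrix.of fun i j => innerₗ E (o i : E) (o j : E)) = 1 := by
    ext i j
    have := orthonormal_iff_ite.1 o.orthonormal i j
    rw [Matrix.of_apply, Matrix.one_apply, ← this]
    rfl
  rw [h2, Matrix.det_one, mul_one] at h1
  have h3 : (Matrix.gram ℝ v) = Matrix.of fun i j => innerₗ E (v i) (v j) := rfl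
  rw [h3, h1, det_bilinForm_apply_eq_sq_mul o B hv]

variable [FiniteDimensional ℝ E]

theorem IsGaugeExpansion.exists_gaussCurvature_eq (hm : finrank ℝ E = m + 1)
    (hK : IsPointedConvexBody K) (hp : p ∈ frontier K) (hexp : IsGaugeExpansion K p L B) :
    ∃ o : OrthonormalBasis (Fin m) ℝ (Submodule.span ℝ {outerNormal K p})ᗮ,
      gaussCurvature K p =
        inner ℝ (outerNormal K p) p ^ m * (Matrix.of fun i j => B (o i) (o j)).det := by
  have hν := isOuterUnitNormal_outerNormal hK hp hexp.hasFDerivAt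
  have hn0 : outerNormal K p ≠ 0 := fun h => by
    have := hν.1
    rw [h, norm_zero] at this
    exact zero_ne_one this
  have hfin : finrank ℝ (Submodule.span ℝ {outerNormal K p})ᗮ = m := by
    have : Fact (finrank ℝ E = m + 1) := ⟨hm⟩
    exact Submodule.finrank_orthogonal_span_singleton hn0
  set o := stdOrthonormalBasis ℝ (Submodule.span ℝ {outerNormal K p})ᗮ with ho
  refine ⟨o.reindex (finCongr hfin), ?_⟩
  have h1 : (Matrix.of fun i j =>
      B (o.reindex (finCongr hfin) i : E) (o.reindex (finCongr hfin) j : E)) =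
      (Matrix.of fun i j => B (o i : E) (o j : E)).submatrix (finCongr hfin).symm
        (finCongr hfin).symm := by
    ext i j
    simp
  have h2 : (Matrix.of fun i j => secondFundamentalForm K p (o i : E) (o j : E)) =
      (inner ℝ (outerNormal K p) p : ℝ) • Matrix.of fun i j => B (o i : E) (o j : E) := by
    ext i j
    rw [Matrix.of_apply, secondFundamentalForm,
      hessianOn_apply (hexp.isHessianOn_boundaryGraph hK hp) (o i).2 (o j).2]
    rfl
  rw [h1, Matrix.det_submatrix_equiv_self]
  calc gaussCurvature K p =
        (Matrix.of fun i j => secondFundamentalForm K p (o i : E) (o j : E)).det := by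
        rw [gaussCurvature, if_pos ⟨hp, L, B, hexp⟩]
    _ = _ := by
        rw [h2, Matrix.det_smul, Fintype.card_fin]
        congr 2

theorem Real.rpow_natCast_div_two {x : ℝ} (hx : 0 ≤ x) (m : ℕ) : x ^ ((m : ℝ) / 2) = √(x ^ m) := by
  rw [Real.sqrt_eq_rpow, ← Real.rpow_natCast, ← Real.rpow_mul hx, mul_one_div]

/-- The centro-projective volume density is the Euclidean area density (the square root of the Gram
determinant) multiplied by the Euclidean integrand. -/
theorem centroProjVolume_eq_sqrt_gram_mul (hm : finrank ℝ E = m + 1) (hK : IsPointedConvexBody K)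
    (hp : p ∈ frontier K) {v : Fin m → E}
    (hv : ∀ L : E →L[ℝ] ℝ, HasFDerivAt (gauge K) L p → ∀ i, L (v i) = 0) :
    centroProjVolume K p v = √(Matrix.gram ℝ v).det *
      (√(gaussCurvature K p)
        / inner ℝ (outerNormal K p) p ^ (((finrank ℝ E : ℝ) - 1) / 2)
        * (2 * antipodalFun K p / (1 + antipodalFun K p)) ^ (((finrank ℝ E : ℝ) - 1) / 2)) := by
  by_cases hsm : IsSmoothBoundaryPoint K p
  · obtain ⟨-, L, B, hexp⟩ := hsm
    have hexp : IsGaugeExpansion K p L B := hexp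
    obtain ⟨o, ho⟩ := hexp.exists_gaussCurvature_eq hm hK hp
    have hν := isOuterUnitNormal_outerNormal hK hp hexp.hasFDerivAt
    obtain ⟨h0, hL⟩ := hν.inner_eq hK hp hexp.hasFDerivAt
    have hLv := hv L hexp.hasFDerivAt
    have hvT : ∀ i, v i ∈ (Submodule.span ℝ {outerNormal K p})ᗮ := fun i => by
      rw [Submodule.mem_orthogonal_singleton_iff_inner_right, hL, hLv i, mul_zero]
    have hκ : 0 ≤ 2 * antipodalFun K p / (1 + antipodalFun K p) := by
      have : 0 ≤ antipodalFun K p := inv_nonneg.2 (gauge_nonneg _)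
      positivity
    have he : ((finrank ℝ E : ℝ) - 1) / 2 = (m : ℝ) / 2 := by
      rw [hm]
      push_cast
      ring
    have hsq : √(inner ℝ (outerNormal K p) p ^ m) ≠ 0 := (Real.sqrt_pos.2 (by positivity)).ne'
    rw [hexp.centroProjVolume_eq hK hp hLv, det_bilinForm_apply_eq_gram_mul o B hvT, he,
      Real.rpow_natCast_div_two h0.le, Real.rpow_natCast_div_two hκ, ho,
      Real.sqrt_mul (pow_nonneg hκ m), Real.sqrt_mul (pow_nonneg h0.le m),
      Real.sqrt_mul (Matrix.posSemidef_gram ℝ v).det_nonneg]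
    field_simp
  · -- in dimension one every boundary point is smooth, otherwise the determinant vanishes
    have hm0 : m ≠ 0 := by
      rintro rfl
      exact hsm (isSmoothBoundaryPoint_of_finrank_eq_one hm hK hp)
    have : Nonempty (Fin m) := ⟨⟨0, Nat.pos_of_ne_zero hm0⟩⟩
    have h1 : (Matrix.of fun i j => centroProjForm K p (v i) (v j)) = 0 := by
      ext i j
      rw [Matrix.of_apply, centroProjForm, if_neg hsm]
      rfl
    rw [centroProjVolume, h1, Matrix.det_zero, gaussCurvature, if_neg hsm]
    simp

end PointwiseIdentity

/-! ### Central charts -/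

section CentralChart

variable {V : Type*} [NormedAddCommGroup V] [NormedSpace ℝ V] {m : ℕ}
  (b : Basis (Fin (m + 1)) ℝ V) {K : Set V} {ε : ℝ}

/-- The central projection inverse to the central charts: the affine coordinates of a point of the
projective space of `V` in the basis `b`. It is `0` where the zeroth coordinate vanishes. -/
noncomputable def centralCoord (p : V) (i : Fin m) : ℝ := b.coord i.succ p / b.coord 0 p

/-- The point over which a central chart projects radially to the boundary. -/
noncomputable def centralVector (ε : ℝ) (u : Fin m → ℝ) : V := ε • (b 0 + ∑ i, u i • b i.succ)

theorem coord_zero_centralVector (u : Fin m → ℝ) : b.coord 0 (centralVector b ε u) = ε := by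
  simp [centralVector, Fin.succ_ne_zero]

theorem coord_succ_centralVector (u : Fin m → ℝ) (i : Fin m) :
    b.coord i.succ (centralVector b ε u) = ε * u i := by
  simp [centralVector, Finsupp.single_apply]

theorem centralVector_ne_zero (hε : ε ≠ 0) (u : Fin m → ℝ) : centralVector b ε u ≠ 0 := by
  intro h
  have := coord_zero_centralVector b (ε := ε) u
  rw [h, map_zero] at this
  exact hε this.symm

theorem centralChart_eq (u : Fin m → ℝ) :
    centralChart b K ε u = (gauge K (centralVector b ε u))⁻¹ • centralVector b ε u := rfl

theorem gauge_centralChart (hK : IsPointedConvexBody K) (hε : ε ≠ 0) (u : Fin m → ℝ) :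
    gauge K (centralChart b K ε u) = 1 := by
  have := hK.gauge_pos (centralVector_ne_zero b hε u)
  rw [centralChart_eq, gauge_smul_of_nonneg (inv_nonneg.2 this.le), smul_eq_mul,
    inv_mul_cancel₀ this.ne']

theorem centralChart_mem_frontier (hK : IsPointedConvexBody K) (hε : ε ≠ 0) (u : Fin m → ℝ) :
    centralChart b K ε u ∈ frontier K :=
  (gauge_eq_one_iff_mem_frontier hK.convex hK.mem_nhds).1 (gauge_centralChart b hK hε u)

theorem coord_zero_centralChart (u : Fin m → ℝ) :
    b.coord 0 (centralChart b K ε u) = (gauge K (centralVector b ε u))⁻¹ * ε := by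
  rw [centralChart_eq, map_smul, coord_zero_centralVector, smul_eq_mul]

theorem centralCoord_centralChart (hK : IsPointedConvexBody K) (hε : ε ≠ 0) (u : Fin m → ℝ) :
    centralCoord b (centralChart b K ε u) = u := by
  have := hK.gauge_pos (centralVector_ne_zero b hε u)
  ext i
  rw [centralCoord, coord_zero_centralChart, centralChart_eq, map_smul, coord_succ_centralVector,
    smul_eq_mul]
  field_simp

theorem centralVector_centralCoord {p : V} (hp : b.coord 0 p ≠ 0) :
    centralVector b ε (centralCoord b p) = (ε / b.coord 0 p) • p := by
  refine b.ext_elem fun i => ?_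
  change b.coord i _ = b.coord i _
  rw [map_smul, smul_eq_mul]
  refine Fin.cases ?_ (fun i => ?_) i
  · rw [coord_zero_centralVector, div_mul_cancel₀ _ hp]
  · rw [coord_succ_centralVector, centralCoord]
    ring

theorem centralChart_centralCoord (hK : IsPointedConvexBody K) {p : V} (hp : p ∈ frontier K)
    (h : 0 < ε * b.coord 0 p) : centralChart b K ε (centralCoord b p) = p := by
  have h0 : b.coord 0 p ≠ 0 := (right_ne_zero_of_mul h.ne')
  have hpos : 0 < ε / b.coord 0 p := by
    rw [div_eq_mul_inv, ← mul_self_mul_inv (b.coord 0 p)⁻¹, inv_inv]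
    have := mul_self_pos.2 (inv_ne_zero h0)
    calc 0 < ((b.coord 0 p)⁻¹ * (b.coord 0 p)⁻¹) * (ε * b.coord 0 p) := mul_pos this h
      _ = _ := by ring
  rw [centralChart_eq, centralVector_centralCoord b h0, gauge_smul_of_nonneg hpos.le,
    hK.gauge_eq_one hp, smul_eq_mul, mul_one, inv_smul_smul₀ hpos.ne']

theorem range_centralChart (hK : IsPointedConvexBody K) (hε : ε ≠ 0) :
    Set.range (centralChart b K ε) = frontier K ∩ {p | 0 < ε * b.coord 0 p} := by
  ext p
  constructor
  · rintro ⟨u, rfl⟩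
    refine ⟨centralChart_mem_frontier b hK hε u, ?_⟩
    have := hK.gauge_pos (centralVector_ne_zero b hε u)
    have h2 := mul_self_pos.2 hε
    change 0 < ε * b.coord 0 (centralChart b K ε u)
    rw [coord_zero_centralChart, mul_left_comm]
    positivity
  · rintro ⟨hp, h⟩
    exact ⟨_, centralChart_centralCoord b hK hp h⟩

/-- The central charts are globally Lipschitz, since the Minkowski functional is bounded below on
the affine hyperplane that they project radially. -/
theorem exists_lipschitzWith_centralChart (hK : IsPointedConvexBody K) (hε : ε ≠ 0) :
    ∃ C, LipschitzWith C (centralChart b K ε) := by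
  have : FiniteDimensional ℝ V := b.finiteDimensional_of_finite
  obtain ⟨C, hC⟩ := hK.convex.lipschitz_gauge hK.mem_nhds
  obtain ⟨R, hR0, hR⟩ := hK.isCompact.isBounded.subset_closedBall_lt 0 0
  have hnorm : ∀ x, ‖x‖ ≤ R * gauge K x := fun x => by
    have := le_gauge_of_subset_closedBall (absorbent_nhds_zero hK.mem_nhds) hR0.le hR (x := x)
    rwa [div_le_iff₀' hR0] at this
  let A : (Fin m → ℝ) →L[ℝ] V :=
    LinearMap.toContinuousLinearMap (Fintype.linearCombination ℝ fun i : Fin m => b i.succ)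
  have hvec : ∀ u u', centralVector b ε u - centralVector b ε u' = ε • A (u - u') := fun u u' => by
    have hA : ∀ u, centralVector b ε u = ε • (b 0 + A u) := fun u => rfl
    rw [hA, hA, ← smul_sub, add_sub_add_left_eq_sub, ← map_sub]
  -- the summand `1` only keeps the denominator of `c` positive
  let c₀ : V →L[ℝ] ℝ := LinearMap.toContinuousLinearMap (b.coord 0)
  set c : ℝ := |ε| / (‖c₀‖ * R + 1) with hc
  have hc0 : 0 < c := by
    have := abs_pos.2 hε
    positivity
  have hlow : ∀ u, c ≤ gauge K (centralVector b ε u) := fun u => by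
    rw [hc, div_le_iff₀' (by positivity)]
    have h1 : |ε| ≤ ‖c₀‖ * ‖centralVector b ε u‖ := by
      have := c₀.le_opNorm (centralVector b ε u)
      rwa [show c₀ (centralVector b ε u) = ε from coord_zero_centralVector b u] at this
    have h2 := hnorm (centralVector b ε u)
    have h3 := gauge_nonneg (s := K) (centralVector b ε u)
    calc |ε| ≤ ‖c₀‖ * (R * gauge K (centralVector b ε u)) := h1.trans (by gcongr)
      _ ≤ _ := by linarith
  refine ⟨_, LipschitzWith.of_dist_le' (K := (c⁻¹ + R * C * c⁻¹) * (|ε| * ‖A‖)) fun u u' => ?_⟩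
  rw [dist_eq_norm, dist_eq_norm, centralChart_eq, centralChart_eq]
  have hyz : ‖centralVector b ε u - centralVector b ε u'‖ ≤ |ε| * ‖A‖ * ‖u - u'‖ := by
    rw [hvec, norm_smul, Real.norm_eq_abs, mul_assoc]
    gcongr
    exact A.le_opNorm _
  have hu := hlow u
  have hu' := hlow u'
  set y := centralVector b ε u
  set z := centralVector b ε u'
  have hy0 : 0 < gauge K y := hc0.trans_le hu
  have hz0 : 0 < gauge K z := hc0.trans_le hu'
  have hsplit : (gauge K y)⁻¹ • y - (gauge K z)⁻¹ • z =
      (gauge K y)⁻¹ • (y - z) + ((gauge K y)⁻¹ - (gauge K z)⁻¹) • z := by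
    module
  have hdiff : |(gauge K y)⁻¹ - (gauge K z)⁻¹| ≤
      (C * ‖y - z‖) * c⁻¹ * (gauge K z)⁻¹ := by
    have e : (gauge K y)⁻¹ - (gauge K z)⁻¹ =
        (gauge K z - gauge K y) * (gauge K y)⁻¹ * (gauge K z)⁻¹ := by
      field_simp
    have h1 : |gauge K z - gauge K y| ≤ C * ‖y - z‖ := by
      have := hC.dist_le_mul z y
      rwa [Real.dist_eq, dist_eq_norm, norm_sub_rev] at this
    rw [e, abs_mul, abs_mul, abs_of_pos (inv_pos.2 hy0), abs_of_pos (inv_pos.2 hz0)]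
    gcongr
  calc ‖(gauge K y)⁻¹ • y - (gauge K z)⁻¹ • z‖
      ≤ (gauge K y)⁻¹ * ‖y - z‖ + |(gauge K y)⁻¹ - (gauge K z)⁻¹| * ‖z‖ := by
        rw [hsplit]
        refine (norm_add_le _ _).trans ?_
        rw [norm_smul, norm_smul, Real.norm_eq_abs, Real.norm_eq_abs, abs_of_pos (inv_pos.2 hy0)]
    _ ≤ c⁻¹ * ‖y - z‖ + ((C * ‖y - z‖) * c⁻¹ * (gauge K z)⁻¹) * (R * gauge K z) := by
        gcongr
        exact hnorm z
    _ = (c⁻¹ + R * C * c⁻¹) * ‖y - z‖ := by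
        field_simp
    _ ≤ (c⁻¹ + R * C * c⁻¹) * (|ε| * ‖A‖ * ‖u - u'‖) := by gcongr
    _ = _ := by ring

theorem injective_fderiv_centralChart (hK : IsPointedConvexBody K) (hε : ε ≠ 0) {u : Fin m → ℝ}
    (hd : DifferentiableAt ℝ (centralChart b K ε) u) :
    Function.Injective (fderiv ℝ (centralChart b K ε) u) := by
  have : FiniteDimensional ℝ V := b.finiteDimensional_of_finite
  have hc : ∀ i, Differentiable ℝ (b.coord i) := fun i =>
    (LinearMap.toContinuousLinearMap (b.coord i)).differentiable
  have h0 : b.coord 0 (centralChart b K ε u) ≠ 0 := by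
    have := hK.gauge_pos (centralVector_ne_zero b hε u)
    rw [coord_zero_centralChart]
    positivity
  have hdc : DifferentiableAt ℝ (centralCoord b) (centralChart b K ε u) :=
    differentiableAt_pi.2 fun i => by
      simpa only [centralCoord, div_eq_mul_inv] using (hc i.succ _).fun_mul ((hc 0 _).fun_inv h0)
  have hcomp : centralCoord b ∘ centralChart b K ε = id :=
    funext (centralCoord_centralChart b hK hε)
  have h1 := fderiv_comp u hdc hd
  rw [hcomp, fderiv_id] at h1
  have h2 : Function.LeftInverse (fderiv ℝ (centralCoord b) (centralChart b K ε u))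
      (fderiv ℝ (centralChart b K ε) u) := fun w => by
    have := congrArg (fun A : (Fin m → ℝ) →L[ℝ] (Fin m → ℝ) => A w) h1
    exact this.symm
  exact h2.injective

theorem apply_fderiv_centralChart_eq_zero (hK : IsPointedConvexBody K) (hε : ε ≠ 0)
    {u : Fin m → ℝ} (hd : DifferentiableAt ℝ (centralChart b K ε) u) {L : V →L[ℝ] ℝ}
    (hL : HasFDerivAt (gauge K) L (centralChart b K ε u)) (w : Fin m → ℝ) :
    L (fderiv ℝ (centralChart b K ε) u w) = 0 := by
  have h1 := hL.comp u hd.hasFDerivAt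
  have h2 : gauge K ∘ centralChart b K ε = fun _ => 1 := funext (gauge_centralChart b hK hε)
  rw [h2] at h1
  have := h1.unique (hasFDerivAt_const (1 : ℝ) u)
  exact congrArg (fun A : (Fin m → ℝ) →L[ℝ] ℝ => A w) this

end CentralChart

/-! ### Integration over the boundary -/

section Integration

variable {E : Type*} [NormedAddCommGroup E] [InnerProductSpace ℝ E]
  [MeasurableSpace E] [BorelSpace E] {K : Set E} {m : ℕ}

/-- The boundary points in a coordinate hyperplane form a null set: in a central chart of a permuted
basis they correspond to a coordinate hyperplane of `ℝᵐ`. -/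
theorem euclideanHausdorffMeasure_frontier_inter_coord_eq_zero
    (b : Basis (Fin (m + 1)) ℝ E) (hK : IsPointedConvexBody K) :
    (μHE[m] : Measure E) (frontier K ∩ {p | b.coord 0 p = 0}) = 0 := by
  let b' : Fin m → Basis (Fin (m + 1)) ℝ E := fun j => b.reindex (Equiv.swap 0 j.succ)
  have hcover : frontier K ∩ {p | b.coord 0 p = 0} ⊆
      ⋃ j : Fin m, ⋃ ε ∈ ({1, -1} : Finset ℝ), centralChart (b' j) K ε '' {u | u j = 0} := by
    rintro p ⟨hp, h0⟩
    have h0 : b.coord 0 p = 0 := h0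
    have hex : ∃ i, b.coord i p ≠ 0 := by
      by_contra! h
      exact hK.ne_zero_of_mem_frontier hp (b.forall_coord_eq_zero_iff.1 h)
    obtain ⟨i, hi⟩ := hex
    obtain ⟨j, rfl⟩ : ∃ j : Fin m, i = j.succ := by
      refine ⟨i.pred ?_, (Fin.succ_pred _ _).symm⟩
      rintro rfl
      exact hi h0
    have hb0 : (b' j).coord 0 p = b.coord j.succ p := by
      simp [b']
    have hbj : (b' j).coord j.succ p = b.coord 0 p := by
      simp [b']
    have hε : ∃ ε ∈ ({1, -1} : Finset ℝ), 0 < ε * (b' j).coord 0 p := by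
      rw [hb0]
      rcases lt_or_gt_of_ne hi with h | h
      · exact ⟨-1, by simp, by linarith⟩
      · exact ⟨1, by simp, by linarith⟩
    obtain ⟨ε, hε, hpos⟩ := hε
    simp only [Set.mem_iUnion]
    refine ⟨j, ε, hε, centralCoord (b' j) p, ?_, centralChart_centralCoord _ hK hp hpos⟩
    change centralCoord (b' j) p j = 0
    rw [centralCoord, hbj, h0, zero_div]
  refine measure_mono_null hcover ?_
  refine measure_iUnion_null fun j => (measure_biUnion_null_iff (Finset.countable_toSet _)).2
    fun ε hε => ?_
  have hε0 : ε ≠ 0 := by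
    rintro rfl
    simp at hε
  obtain ⟨C, hC⟩ := exists_lipschitzWith_centralChart (b' j) hK hε0
  exact hC.euclideanHausdorffMeasure_image_eq_zero (Measure.pi_hyperplane _ j 0)

/-- The integral over the boundary with respect to the Euclidean area, computed in the two central
charts of a basis. -/
theorem lintegral_frontier_eq_sum_centralChart [FiniteDimensional ℝ E]
    (b : Basis (Fin (m + 1)) ℝ E) (hK : IsPointedConvexBody K) (g : E → ENNReal) :
    ∫⁻ p in frontier K, g p ∂(μHE[m] : Measure E) =
      ∑ ε ∈ ({1, -1} : Finset ℝ), ∫⁻ u : Fin m → ℝ, ENNReal.ofReal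
        √(Matrix.gram ℝ fun i => fderiv ℝ (centralChart b K ε) u (Pi.single i 1)).det *
          g (centralChart b K ε u) := by
  have harea : ∀ ε : ℝ, ε ≠ 0 → ∫⁻ u : Fin m → ℝ, ENNReal.ofReal
        √(Matrix.gram ℝ fun i => fderiv ℝ (centralChart b K ε) u (Pi.single i 1)).det *
          g (centralChart b K ε u) =
      ∫⁻ p in frontier K ∩ {p | 0 < ε * b.coord 0 p}, g p ∂(μHE[m] : Measure E) := by
    intro ε hε
    obtain ⟨C, hC⟩ := exists_lipschitzWith_centralChart b hK hε
    rw [← range_centralChart b hK hε, hC.lintegral_range_eq_lintegral_gram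
      (Function.LeftInverse.injective (centralCoord_centralChart b hK hε))
      fun u hu => injective_fderiv_centralChart b hK hε hu]
  have hcont : Continuous (b.coord 0) :=
    (LinearMap.toContinuousLinearMap (b.coord 0)).continuous
  have hmeas : ∀ ε : ℝ, MeasurableSet (frontier K ∩ {p | 0 < ε * b.coord 0 p}) := fun ε =>
    isClosed_frontier.measurableSet.inter
      (isOpen_lt continuous_const (continuous_const.mul hcont)).measurableSet
  rw [Finset.sum_pair (by norm_num), harea 1 one_ne_zero, harea (-1) (by norm_num),
    ← lintegral_union (hmeas _)]
  · refine setLIntegral_congr (ae_eq_set.2 ⟨?_, ?_⟩)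
    · refine measure_mono_null ?_ (euclideanHausdorffMeasure_frontier_inter_coord_eq_zero b hK)
      rintro p ⟨hp, hn⟩
      refine ⟨hp, ?_⟩
      by_contra h0
      rcases lt_or_gt_of_ne h0 with h | h
      · exact hn (Or.inr ⟨hp, show 0 < -1 * b.coord 0 p by linarith⟩)
      · exact hn (Or.inl ⟨hp, show 0 < 1 * b.coord 0 p by linarith⟩)
    · rw [Set.sdiff_eq_empty.2 (Set.union_subset Set.inter_subset_left Set.inter_subset_left)]
      exact measure_empty
  · rw [Set.disjoint_left]
    rintro p ⟨-, h1⟩ ⟨-, h2⟩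
    have h1 : 0 < 1 * b.coord 0 p := h1
    have h2 : 0 < -1 * b.coord 0 p := h2
    linarith

/-- The integral formula for the centro-projective area. -/
theorem centroProjArea_eq_centroProjAreaEuclid [FiniteDimensional ℝ E]
    (b : Basis (Fin (m + 1)) ℝ E) (hK : IsPointedConvexBody K) :
    centroProjArea b K = centroProjAreaEuclid K := by
  have hm : finrank ℝ E = m + 1 := by simpa using finrank_eq_card_basis b
  have hm' : finrank ℝ E - 1 = m := by omega
  rw [centroProjAreaEuclid, hm', lintegral_frontier_eq_sum_centralChart b hK, centroProjArea,
    boundaryDensityIntegral]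
  refine Finset.sum_congr rfl fun ε hε => ?_
  have hε0 : ε ≠ 0 := by
    rintro rfl
    simp at hε
  obtain ⟨C, hC⟩ := exists_lipschitzWith_centralChart b hK hε0
  refine lintegral_congr_ae ?_
  filter_upwards [hC.ae_differentiableAt] with u hu
  rw [← ENNReal.ofReal_mul (Real.sqrt_nonneg _)]
  congr 1
  exact centroProjVolume_eq_sqrt_gram_mul hm hK (centralChart_mem_frontier b hK hε0 u)
    fun L hL i => apply_fderiv_centralChart_eq_zero b hK hε0 hu hL _

end Integration

/-! ### Linear invariance of the intrinsic area -/

section Invariance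

variable {V W : Type*} [NormedAddCommGroup V] [NormedSpace ℝ V]
  [NormedAddCommGroup W] [NormedSpace ℝ W] {K : Set V} {p : V} {m : ℕ}

theorem gauge_image_linearEquiv (T : V ≃ₗ[ℝ] W) (K : Set V) (x : V) :
    gauge (T '' K) (T x) = gauge K x := by
  rw [gauge_def', gauge_def']
  congr! 3 with r
  rw [← map_smul, T.injective.mem_set_image]

theorem antipodalFun_image_linearEquiv (T : V ≃ₗ[ℝ] W) (K : Set V) (p : V) :
    antipodalFun (T '' K) (T p) = antipodalFun K p := by
  rw [antipodalFun, antipodalFun, ← map_neg, gauge_image_linearEquiv]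

theorem centralChart_map (b : Basis (Fin (m + 1)) ℝ V) (T : V ≃ₗ[ℝ] W) (K : Set V) (ε : ℝ) :
    centralChart (b.map T) (T '' K) ε = T ∘ centralChart b K ε := by
  ext u
  have h : centralVector (b.map T) ε u = T (centralVector b ε u) := by
    simp [centralVector]
  rw [Function.comp_apply, centralChart_eq, centralChart_eq, h, gauge_image_linearEquiv, map_smul]

theorem IsGaugeExpansion.image [FiniteDimensional ℝ W] {L : V →L[ℝ] ℝ} {B : LinearMap.BilinForm ℝ V}
    (h : IsGaugeExpansion K p L B) (T : V ≃ₗ[ℝ] W) :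
    IsGaugeExpansion (T '' K) (T p) (L.comp (T.symm.toContinuousLinearEquiv : W →L[ℝ] V))
      (LinearMap.compl₁₂ B T.symm.toLinearMap T.symm.toLinearMap) := by
  refine ⟨⟨fun v w => h.1.eq _ _⟩, ?_⟩
  have ht : Filter.Tendsto T.symm (𝓝 0) (𝓝 0) := by
    have := T.symm.toContinuousLinearEquiv.continuous.tendsto 0
    rwa [map_zero] at this
  refine ((h.2.comp_tendsto ht).congr_left fun w => ?_).trans_isBigO ?_
  · obtain ⟨v, rfl⟩ := T.surjective w
    have e1 := gauge_image_linearEquiv T K (p + v)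
    rw [map_add] at e1
    rw [e1, gauge_image_linearEquiv]
    simp
  · exact ((T.symm.toContinuousLinearEquiv : W →L[ℝ] V).isBigO_id (𝓝 0)).norm_norm.pow 2

variable [FiniteDimensional ℝ V]

theorem IsPointedConvexBody.image (hK : IsPointedConvexBody K) (T : V ≃ₗ[ℝ] W) :
    IsPointedConvexBody (T '' K) where
  convex := hK.convex.linear_image T.toLinearMap
  isCompact := hK.isCompact.image T.toContinuousLinearEquiv.continuous
  zero_mem_interior := by
    have := T.toContinuousLinearEquiv.toHomeomorph.image_interior K
    change T '' interior K = interior (T '' K) at this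
    rw [← this]
    exact ⟨0, hK.zero_mem_interior, map_zero T⟩

theorem frontier_image_linearEquiv (T : V ≃ₗ[ℝ] W) (K : Set V) :
    frontier (T '' K) = T '' frontier K :=
  (T.toContinuousLinearEquiv.toHomeomorph.image_frontier K).symm

variable [FiniteDimensional ℝ W]

theorem isSmoothBoundaryPoint_image_iff (T : V ≃ₗ[ℝ] W) :
    IsSmoothBoundaryPoint (T '' K) (T p) ↔ IsSmoothBoundaryPoint K p := by
  constructor
  · rintro ⟨hp, L, B, h⟩
    have h' := IsGaugeExpansion.image h T.symm
    rw [frontier_image_linearEquiv, T.injective.mem_set_image] at hp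
    rw [← Set.image_comp, T.symm_apply_apply] at h'
    simp only [Function.comp_def, LinearEquiv.symm_apply_apply, Set.image_id'] at h'
    exact ⟨hp, _, _, h'⟩
  · rintro ⟨hp, L, B, h⟩
    refine ⟨?_, _, _, IsGaugeExpansion.image h T⟩
    rw [frontier_image_linearEquiv]
    exact Set.mem_image_of_mem _ hp

theorem centroProjVolume_image (hK : IsPointedConvexBody K) (hp : p ∈ frontier K) (T : V ≃ₗ[ℝ] W)
    {v : Fin m → V}
    (hv : ∀ L : V →L[ℝ] ℝ, HasFDerivAt (gauge K) L p → ∀ i, L (v i) = 0) :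
    centroProjVolume (T '' K) (T p) (fun i => T (v i)) = centroProjVolume K p v := by
  by_cases hsm : IsSmoothBoundaryPoint K p
  · obtain ⟨-, L, B, h⟩ := hsm
    have h : IsGaugeExpansion K p L B := h
    have hv := hv L h.hasFDerivAt
    have hp' : T p ∈ frontier (T '' K) := by
      rw [frontier_image_linearEquiv]
      exact Set.mem_image_of_mem _ hp
    rw [(h.image T).centroProjVolume_eq (hK.image T) hp' fun i => ?_,
      h.centroProjVolume_eq hK hp hv, antipodalFun_image_linearEquiv]
    · simp
    · simpa using hv i
  · simp only [centroProjVolume, centroProjForm, if_neg hsm,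
      if_neg (mt (isSmoothBoundaryPoint_image_iff T).1 hsm), LinearMap.zero_apply]

/-- The intrinsic centro-projective area is invariant under linear isomorphisms. -/
theorem centroProjArea_map (b : Basis (Fin (m + 1)) ℝ V) (hK : IsPointedConvexBody K)
    (T : V ≃ₗ[ℝ] W) : centroProjArea (b.map T) (T '' K) = centroProjArea b K := by
  rw [centroProjArea, centroProjArea, boundaryDensityIntegral, boundaryDensityIntegral]
  refine Finset.sum_congr rfl fun ε hε => ?_
  have hε0 : ε ≠ 0 := by
    rintro rfl
    simp at hε
  obtain ⟨C, hC⟩ := exists_lipschitzWith_centralChart b hK hε0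
  refine lintegral_congr_ae ?_
  filter_upwards [hC.ae_differentiableAt] with u hu
  have hd : fderiv ℝ (T ∘ centralChart b K ε) u =
      (T.toContinuousLinearEquiv : V →L[ℝ] W).comp (fderiv ℝ (centralChart b K ε) u) :=
    T.toContinuousLinearEquiv.comp_fderiv
  rw [centralChart_map, hd]
  congr 1
  exact centroProjVolume_image hK (centralChart_mem_frontier b hK hε0 u) T
    fun L hL i => apply_fderiv_centralChart_eq_zero b hK hε0 hu hL _

end Invariance

theorem proposition4p1 {E : Type*} [NormedAddCommGroup E] [InnerProductSpace ℝ E]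
    [FiniteDimensional ℝ E] [MeasurableSpace E] [BorelSpace E]
    (m : ℕ) (hm : Module.finrank ℝ E = m + 1)
    (K : Set E) (hK : IsPointedConvexBody K) :
    (∀ b : Module.Basis (Fin (m + 1)) ℝ E, centroProjArea b K = centroProjAreaEuclid K) ∧
    ∀ (E' : Type*) [NormedAddCommGroup E'] [InnerProductSpace ℝ E']
      [FiniteDimensional ℝ E'] [MeasurableSpace E'] [BorelSpace E'] (T : E ≃ₗ[ℝ] E'),
      centroProjAreaEuclid (T '' K) = centroProjAreaEuclid K := by
  refine ⟨fun b => centroProjArea_eq_centroProjAreaEuclid b hK, ?_⟩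
  intro E' _ _ _ _ _ T
  have b := finBasisOfFinrankEq ℝ E hm
  rw [← centroProjArea_eq_centroProjAreaEuclid b hK,
    ← centroProjArea_eq_centroProjAreaEuclid (b.map T) (hK.image T), centroProjArea_map b hK T]
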